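/- **Setting.** Let $\mathfrak g=\mathfrak{sl}(3,\mathbb R)$ with the basis $A_1=E_{13},\ A_2=E_{12},\ A_3=E_{23},\ A_4=E_{11}-E_{22},\ A_5=E_{22}-E_{33},\ A_6=E_{32},\ A_7=E_{21},\ A_8=E_{31}$, write $e_0=A_8,\ e_1=A_7,\ e_2=A_6$ and $\check e_0=A_1,\ \check e_1=A_2,\ \check e_2=A_3$, and give $\mathfrak g$ the contact grading, in which $A_1,\dots,A_8$ have degrees $2,1,1,0,0,-1,-1,-2$. Let $\mathfrak g_-=\langle e_0,e_1,e_2\rangle$ and $\mathfrak g^0=\langle A_1,\dots,A_5\rangle$, and let $G^0\subset SL(3,\mathbb R)$ be the group of upper triangular matrices. Let $V=\mathfrak g$ be the adjoint module with its grading, $\kappa$ the Killing form, $\mathfrak l=\mathfrak o(V,\kappa)\subset\mathfrak{gl}(V)$ with the induced grading, and $\mathfrak l=\mathfrak g\oplus\mathfrak g^\perp$, where $\mathfrak g$ is embedded by $\operatorname{ad}$ and $\mathfrak g^\perp$ is its orthogonal complement for the form $\operatorname{tr}(XY)$. With the dual basis $A_i^*$ of $V^*$, put $$R_{2,1}=A_1\otimes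 A_7^*-A_2\otimes A_8^*,\quad R_{-1,1}=[e_1,[e_1,[e_1,R_{2,1}]]],\quad S_{1,2}=A_1\otimes A_6^*-A_3\otimes A_8^*,\quad S_{1,-1}=[e_2,[e_2,[e_2,S_{1,2}]]],$$ and $\xi_1^R=R_{-1,1}\otimes e_2^*$, $\xi_1^S=S_{1,-1}\otimes e_1^*$ in $\operatorname{Hom}(\mathfrak g_-,\mathfrak g^\perp)$. Let $P\to M$ be a smooth principal $G^0$-bundle over a $3$-dimensional manifold $M$, and let $\omega=\omega_I+\omega_{II}$ (with $\omega_I\in\mathfrak g$, $\omega_{II}\in\mathfrak g^\perp$) be a smooth $\mathfrak l$-valued $1$-form on $P$ that is a normal extrinsic Cartan connection, i.e. 1. $\omega(\tilde A)=A$ for the fundamental vector field $\tilde A$ of each $A\in\mathfrak g^0$; 2. $R_a^*\omega=\operatorname{Ad}(a^{-1})\omega$ for $a\in G^0$; 3. $d\omega+\tfrac12[\omega,\omega]=0$; 4. $\omega_I\colon T_zP\to\mathfrak g$ is a linear isomorphism for every $z\in P$; 5. the function $\chi$ on $P$ defined by $\omega_{II}=\chi\,\omega_I$ takes values in $\operatorname{Hom}(\mathfrak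 g_-,\mathfrak g^\perp)$ (it vanishes on $\mathfrak g^0$), satisfies $\partial^*\chi=\sum_{k=0}^{2}[\check e_k,\chi(e_k)]=0$, and its homogeneous components $\chi_j$ of degree $j\le 0$ vanish. (These are the properties of the bundle and form canonically attached to an osculating map of $\mathfrak{sl}_3$-type.) For a function $f$ on $P$ let $D_{e_k}f$ be its derivative along the vector field $\tilde e_k$ with $\omega_I(\tilde e_k)=e_k$. **Proposition (compatibility conditions).** There are smooth functions $h_1^R,h_1^S$ on $P$ with $\chi_1=h_1^R\,\xi_1^R+h_1^S\,\xi_1^S$. The functions $h_1^R,h_1^S$ determined by this identity satisfy $$\big(D_{e_0}+\tfrac14D_{e_2}D_{e_1}\big)h_1^R=0,\qquad \big(D_{e_0}-\tfrac14D_{e_1}D_{e_2}\big)h_1^S=0,$$ and $$D_{e_2}^5h_1^S=-6\,(D_{e_1}^4h_1^R)\,h_1^R+6\,(D_{e_1}^3h_1^R)(D_{e_1}h_1^R)-3\,(D_{e_1}^2h_1^R)^2,$$ $$D_{e_1}^5h_1^R=6\,(D_{e_2}^4h_1^S)\,h_1^S-6\,(D_{e_2}^3h_1^S)(D_{e_2}h_1^S)+3\,(D_{e_2}^2h_1^S)^2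 .$$ -/

import Mathlib

open scoped Manifold ContDiff Matrix

namespace SL3Type

/-! ### The Lie algebra `𝔤 = 𝔰𝔩(3, ℝ)` and its adjoint module `V = ℝ⁸`

Indices of `Fin 8` are the indices of the basis `A₁, …, A₈` of `𝔰𝔩(3, ℝ)`, shifted by one.
Through this basis `𝔰𝔩(3, ℝ)` is identified with `Fin 8 → ℝ`, and `𝔤𝔩(V)` with `8 × 8` matrices. -/

/-- The basis `E₁₃, E₁₂, E₂₃, H₁ = E₁₁ - E₂₂, H₂ = E₂₂ - E₃₃, E₃₂, E₂₁, E₃₁` of `𝔰𝔩(3, ℝ)`. -/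
def A : Fin 8 → Matrix (Fin 3) (Fin 3) ℝ :=
  ![Matrix.single 0 2 1, Matrix.single 0 1 1, Matrix.single 1 2 1,
    Matrix.single 0 0 1 - Matrix.single 1 1 1, Matrix.single 1 1 1 - Matrix.single 2 2 1,
    Matrix.single 2 1 1, Matrix.single 1 0 1, Matrix.single 2 0 1]

/-- The element `∑ cᵢ Aᵢ` of `𝔰𝔩(3, ℝ)` with coordinates `c`. -/
def toMat (c : Fin 8 → ℝ) : Matrix (Fin 3) (Fin 3) ℝ := ∑ i, c i • A i

/-- The coordinates, in the basis `A`, of a trace-free `3 × 3` matrix. -/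
def coords (X : Matrix (Fin 3) (Fin 3) ℝ) : Fin 8 → ℝ :=
  ![X 0 2, X 0 1, X 1 2, X 0 0, -X 2 2, X 2 1, X 1 0, X 2 0]

theorem coords_toMat (c : Fin 8 → ℝ) : coords (toMat c) = c := by
  funext i
  fin_cases i <;> simp [coords, toMat, A, Fin.sum_univ_eight]

theorem toMat_coords (X : Matrix (Fin 3) (Fin 3) ℝ) (hX : X.trace = 0) :
    toMat (coords X) = X := by
  rw [Matrix.trace_fin_three] at hX
  ext i j
  fin_cases i <;> fin_cases j <;>
    simp [coords, toMat, A, Fin.sum_univ_eight]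
  linarith

/-- The matrix of `ad X` on `V = 𝔰𝔩(3, ℝ)` in the basis `A`. -/
def adM (X : Matrix (Fin 3) (Fin 3) ℝ) : Matrix (Fin 8) (Fin 8) ℝ :=
  Matrix.of fun i j => coords (X * A j - A j * X) i

/-- The matrix, in the basis `A`, of the Killing form `κ(X, Y) = tr (ad X ad Y)` of `𝔰𝔩(3, ℝ)`. -/
def killingM : Matrix (Fin 8) (Fin 8) ℝ :=
  Matrix.of fun i j => (adM (A i) * adM (A j)).trace

/-- `𝔩 = 𝔬(V, κ) ⊂ 𝔤𝔩(V)`. -/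
def orthAlg : Set (Matrix (Fin 8) (Fin 8) ℝ) :=
  {X | Xᵀ * killingM + killingM * X = 0}

/-- The coordinates of the `𝔤`-component of `X ∈ 𝔩 = 𝔤 ⊕ 𝔤^⊥`, where `𝔤^⊥` is the orthogonal
complement of `ad 𝔤` in `𝔩` for the invariant form `tr (XY)`: the unique `c` such that
`tr ((X - ad (∑ cⱼ Aⱼ)) ad Aᵢ) = 0` for all `i`. (The Killing form is nondegenerate.) -/
noncomputable def gPart (X : Matrix (Fin 8) (Fin 8) ℝ) : Fin 8 → ℝ :=
  killingM⁻¹ *ᵥ fun i => (X * adM (A i)).trace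

/-- The `𝔤^⊥`-component of `X ∈ 𝔩 = 𝔤 ⊕ 𝔤^⊥`. -/
noncomputable def perpPart (X : Matrix (Fin 8) (Fin 8) ℝ) : Matrix (Fin 8) (Fin 8) ℝ :=
  X - adM (toMat (gPart X))

/-- The grading of `V`, up to a shift: `A i` has degree `deg i` in the contact grading. -/
def deg : Fin 8 → ℤ := ![2, 1, 1, 0, 0, -1, -1, -2]

/-- The component of degree `p` of an element of `𝔤𝔩(V) = ⨁ 𝔤𝔩(V)_p`. -/
def degPart (p : ℤ) (X : Matrix (Fin 8) (Fin 8) ℝ) : Matrix (Fin 8) (Fin 8) ℝ :=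
  Matrix.of fun i j => if deg i - deg j = p then X i j else 0

/-! ### Cochains `Hom(𝔤₋, 𝔤𝔩(V))`

The basis of `𝔤₋` is `e₀ = E₃₁, e₁ = E₂₁, e₂ = E₃₂`; the opposite elements are
`ě₀ = E₁₃, ě₁ = E₁₂, ě₂ = E₂₃`.  A linear map on `𝔤₋` is given by its values on `e₀, e₁, e₂`. -/

/-- `eIdx k` is the index of `e_k` in the basis `A`. -/
def eIdx : Fin 3 → Fin 8 := ![7, 6, 5]

/-- `eCheckIdx k` is the index of `ě_k` in the basis `A`. -/
def eCheckIdx : Fin 3 → Fin 8 := ![0, 1, 2]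

/-- `1`-cochains on `𝔤₋` with values in `𝔤𝔩(V)`; `c k` is the value on `e_k`. -/
abbrev Cochain : Type := Fin 3 → Matrix (Fin 8) (Fin 8) ℝ

/-- The component of degree `p` of a cochain: `𝔤_q` goes to degree `q + p`. -/
def cochainPart (p : ℤ) (c : Cochain) : Cochain := fun k => degPart (deg (eIdx k) + p) (c k)

/-- The codifferential `∂* : C¹(𝔤₋, 𝔤^⊥) → C⁰(𝔤₋, 𝔤^⊥)`, adjoint to the Lie algebra cohomology
differential: `∂* c = ∑ₖ [ě_k, c(e_k)]` (`ě_k` is the basis of `𝔤₊` dual to `e_k` for `tr (XY)`). -/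
def codiff (c : Cochain) : Matrix (Fin 8) (Fin 8) ℝ :=
  ∑ k, ⁅adM (A (eCheckIdx k)), c k⁆

/-- The weight vector `R_{2,1} = A₁ ⊗ A₇* - A₂ ⊗ A₈*`. -/
def R21 : Matrix (Fin 8) (Fin 8) ℝ := Matrix.single 0 6 1 - Matrix.single 1 7 1

/-- The weight vector `R_{-1,1} = [e₁, [e₁, [e₁, R_{2,1}]]]`. -/
def Rm11 : Matrix (Fin 8) (Fin 8) ℝ :=
  ⁅adM (A (eIdx 1)), ⁅adM (A (eIdx 1)), ⁅adM (A (eIdx 1)), R21⁆⁆⁆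

/-- The weight vector `S_{1,2} = A₁ ⊗ A₆* - A₃ ⊗ A₈*`. -/
def S12 : Matrix (Fin 8) (Fin 8) ℝ := Matrix.single 0 5 1 - Matrix.single 2 7 1

/-- The weight vector `S_{1,-1} = [e₂, [e₂, [e₂, S_{1,2}]]]`. -/
def S1m1 : Matrix (Fin 8) (Fin 8) ℝ :=
  ⁅adM (A (eIdx 2)), ⁅adM (A (eIdx 2)), ⁅adM (A (eIdx 2)), S12⁆⁆⁆

/-- `ξ₁ᴿ = R_{-1,1} ⊗ e₂*`. -/
def xiR : Cochain := Pi.single 2 Rm11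

/-- `ξ₁ˢ = S_{1,-1} ⊗ e₁*`. -/
def xiS : Cochain := Pi.single 1 S1m1

/-! ### The structure group `G⁰`: upper triangular matrices in `SL(3, ℝ)` -/

/-- The group `G⁰ = φ⁰G` of upper triangular matrices in `G = SL(3, ℝ)`. -/
def G0 : Subgroup (Matrix.SpecialLinearGroup (Fin 3) ℝ) where
  carrier := {g | g 1 0 = 0 ∧ g 2 0 = 0 ∧ g 2 1 = 0}
  one_mem' := by simp
  mul_mem' := by
    rintro a b ⟨h1, h2, h3⟩ ⟨k1, k2, k3⟩
    simp [Matrix.mul_apply, Fin.sum_univ_three, h1, h2, h3, k1, k2, k3]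
  inv_mem' := by
    rintro a ⟨h1, h2, h3⟩
    simp [Matrix.SpecialLinearGroup.coe_inv, Matrix.adjugate_fin_three, h1, h2, h3]

/-- Global coordinates on `G⁰`: the entries `g₁₁, g₂₂, g₁₂, g₁₃, g₂₃`. -/
def G0coord (g : G0) : EuclideanSpace ℝ (Fin 5) :=
  !₂[g.1 0 0, g.1 1 1, g.1 0 1, g.1 0 2, g.1 1 2]

theorem G0coord_continuous : Continuous G0coord := by
  have h : Continuous fun g : G0 => (g.1 : Matrix (Fin 3) (Fin 3) ℝ) :=
    continuous_subtype_val.comp continuous_subtype_val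
  refine (PiLp.continuous_toLp 2 _).comp (continuous_pi fun i => ?_)
  fin_cases i
  · exact h.matrix_elem 0 0
  · exact h.matrix_elem 1 1
  · exact h.matrix_elem 0 1
  · exact h.matrix_elem 0 2
  · exact h.matrix_elem 1 2

/-- The element of `G⁰` with given coordinates, on the open set where it exists. -/
noncomputable def G0mk (x : {x : EuclideanSpace ℝ (Fin 5) // x 0 ≠ 0 ∧ x 1 ≠ 0}) : G0 :=
  ⟨⟨!![x.1 0, x.1 2, x.1 3; 0, x.1 1, x.1 4; 0, 0, (x.1 0 * x.1 1)⁻¹], by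
    have h0 := x.2.1
    have h1 := x.2.2
    simp [Matrix.det_fin_three]
    field_simp⟩, by
    refine ⟨?_, ?_, ?_⟩ <;> rfl⟩

theorem G0mk_continuous : Continuous G0mk := by
  refine Continuous.subtype_mk (Continuous.subtype_mk (continuous_matrix fun i j => ?_) _) _
  have hc : ∀ k, Continuous
      fun x : {x : EuclideanSpace ℝ (Fin 5) // x 0 ≠ 0 ∧ x 1 ≠ 0} => x.1 k := fun k => by
    fun_prop
  fin_cases i <;> fin_cases j <;>
    first
    | exact hc _
    | exact continuous_const
    | exact ((hc 0).mul (hc 1)).inv₀ fun x => mul_ne_zero x.2.1 x.2.2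

theorem G0_det (g : G0) : g.1 0 0 * g.1 1 1 * g.1 2 2 = 1 := by
  obtain ⟨⟨g, hg⟩, h1, h2, h3⟩ := g
  have := hg
  rw [Matrix.det_fin_three] at this
  change g 1 0 = 0 at h1
  change g 2 0 = 0 at h2
  change g 2 1 = 0 at h3
  change g 0 0 * g 1 1 * g 2 2 = 1
  rw [h1, h2, h3] at this
  linarith

theorem G0coord_ne (g : G0) : G0coord g 0 ≠ 0 ∧ G0coord g 1 ≠ 0 := by
  have h := G0_det g
  constructor
  · change g.1 0 0 ≠ 0
    intro h0
    simp [h0] at h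
  · change g.1 1 1 ≠ 0
    intro h0
    simp [h0] at h

theorem G0mk_coord (g : G0) : G0mk ⟨G0coord g, G0coord_ne g⟩ = g := by
  have h := G0_det g
  obtain ⟨k0, k1⟩ := G0coord_ne g
  obtain ⟨h1, h2, h3⟩ := g.2
  apply Subtype.ext
  apply Subtype.ext
  ext i j
  fin_cases i <;> fin_cases j <;> first | rfl | exact h1.symm | exact h2.symm | exact h3.symm | skip
  change (g.1 0 0 * g.1 1 1)⁻¹ = g.1 2 2
  exact inv_eq_of_mul_eq_one_right h

theorem G0coord_mk (x : {x : EuclideanSpace ℝ (Fin 5) // x 0 ≠ 0 ∧ x 1 ≠ 0}) :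
    G0coord (G0mk x) = x.1 := by
  ext i
  fin_cases i <;> rfl

theorem G0_isOpenEmbedding : Topology.IsOpenEmbedding G0coord := by
  have hopen : IsOpen {x : EuclideanSpace ℝ (Fin 5) | x 0 ≠ 0 ∧ x 1 ≠ 0} :=
    (isOpen_ne_fun (by fun_prop) (by fun_prop)).inter (isOpen_ne_fun (by fun_prop) (by fun_prop))
  let e : G0 ≃ₜ {x : EuclideanSpace ℝ (Fin 5) // x 0 ≠ 0 ∧ x 1 ≠ 0} :=
    { toFun := fun g => ⟨G0coord g, G0coord_ne g⟩
      invFun := G0mk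
      left_inv := G0mk_coord
      right_inv := fun x => Subtype.ext (G0coord_mk x)
      continuous_toFun := G0coord_continuous.subtype_mk _
      continuous_invFun := G0mk_continuous }
  exact hopen.isOpenEmbedding_subtypeVal.comp e.isOpenEmbedding

noncomputable instance : ChartedSpace (EuclideanSpace ℝ (Fin 5)) G0 :=
  G0_isOpenEmbedding.singletonChartedSpace

instance : IsManifold (𝓡 5) ∞ G0 := G0_isOpenEmbedding.isManifold_singleton

/-- The matrix of `Ad g` on `V = 𝔰𝔩(3, ℝ)` in the basis `A`. -/
noncomputable def AdM (g : Matrix.SpecialLinearGroup (Fin 3) ℝ) : Matrix (Fin 8) (Fin 8) ℝ :=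
  Matrix.of fun i j =>
    coords ((g : Matrix (Fin 3) (Fin 3) ℝ) * A j * ((g⁻¹ : Matrix.SpecialLinearGroup (Fin 3) ℝ) :
      Matrix (Fin 3) (Fin 3) ℝ)) i

/-! ### Cartan bundles -/

section Bundles

variable (M P : Type*) [TopologicalSpace M] [ChartedSpace (EuclideanSpace ℝ (Fin 3)) M]
  [IsManifold (𝓡 3) ∞ M] [TopologicalSpace P] [ChartedSpace (EuclideanSpace ℝ (Fin 8)) P]
  [IsManifold (𝓡 8) ∞ P]

/-- A smooth principal bundle `P → M` with structure group `G⁰` acting on the right. -/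
structure PrincipalG0Bundle where
  proj : P → M
  act : P → G0 → P
  smooth_proj : ContMDiff (𝓡 8) (𝓡 3) ∞ proj
  smooth_act : ContMDiff ((𝓡 8).prod (𝓡 5)) (𝓡 8) ∞ fun p : P × G0 => act p.1 p.2
  act_one : ∀ z, act z 1 = z
  act_mul : ∀ z a b, act z (a * b) = act (act z a) b
  proj_act : ∀ z a, proj (act z a) = proj z
  /-- Equivariant local trivializations `U × G⁰ ≅ π⁻¹(U)`. -/
  locTriv : ∀ x : M, ∃ (U : Set M) (T : PartialDiffeomorph ((𝓡 3).prod (𝓡 5)) (𝓡 8) (M × G0) P ∞),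
    IsOpen U ∧ x ∈ U ∧ T.source = U ×ˢ Set.univ ∧ T.target = proj ⁻¹' U ∧
      ∀ y ∈ U, ∀ g, proj (T (y, g)) = y ∧ ∀ a, T (y, g * a) = act (T (y, g)) a

variable {P}

/-- Smooth vector fields. -/
def IsSmoothField (X : (z : P) → TangentSpace (𝓡 8) z) : Prop :=
  ContMDiff (𝓡 8) (𝓡 8).tangent ∞ fun z => (⟨z, X z⟩ : TangentBundle (𝓡 8) P)

/-- The derivative of a function along a vector field. -/
noncomputable def lieD (X : (z : P) → TangentSpace (𝓡 8) z) (f : P → ℝ) : P → ℝ :=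
  fun z => mfderiv (𝓡 8) 𝓘(ℝ, ℝ) f z (X z)

variable (P)

/-- A principal `G⁰`-bundle with an `𝔩`-valued `1`-form `ω` that reproduces the generators of
fundamental vector fields, is `G⁰`-equivariant, satisfies `dω + ½[ω, ω] = 0`, and whose
`𝔤`-component `ω_I` is a linear isomorphism on every tangent space. -/
structure ExtrinsicCartanBundle extends PrincipalG0Bundle M P where
  form : (z : P) → TangentSpace (𝓡 8) z →ₗ[ℝ] Matrix (Fin 8) (Fin 8) ℝ
  smooth_form : ∀ i j, ContMDiff (𝓡 8).tangent 𝓘(ℝ, ℝ) ∞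
    fun v : TangentBundle (𝓡 8) P => form v.1 v.2 i j
  form_mem : ∀ z v, form z v ∈ orthAlg
  /-- `⟨Ã, ω⟩ = A` for `A ∈ 𝔤⁰`, where `Ã_z` is the velocity at `t = 0` of `z · c(t)`, for a
  smooth curve `c` in `G⁰` with `c(0) = 1` and `c'(0) = A`. -/
  form_fundamental : ∀ (z : P) (c : ℝ → G0) (B : Matrix (Fin 3) (Fin 3) ℝ), c 0 = 1 →
    ContMDiff 𝓘(ℝ, ℝ) (𝓡 5) ∞ c → (∀ i j, HasDerivAt (fun t => (c t).1 i j) (B i j) 0) →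
    form (act z (c 0)) (mfderiv 𝓘(ℝ, ℝ) (𝓡 8) (fun t => act z (c t)) 0 (1 : ℝ)) = adM B
  /-- `R_a^* ω = Ad(a⁻¹) ω`. -/
  form_equivariant : ∀ (a : G0) (z : P) (v : TangentSpace (𝓡 8) z),
    form (act z a) (mfderiv (𝓡 8) (𝓡 8) (fun y => act y a) z v) =
      AdM (a⁻¹ : G0).1 * form z v * AdM a.1
  /-- `dω + ½[ω, ω] = 0`, evaluated on smooth vector fields `X, Y`. -/
  form_flat : ∀ X Y : (z : P) → TangentSpace (𝓡 8) z, IsSmoothField X → IsSmoothField Y →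
    ∀ z i j, lieD X (fun y => form y (Y y) i j) z - lieD Y (fun y => form y (X y) i j) z
      - form z (VectorField.mlieBracket (𝓡 8) X Y z) i j + ⁅form z (X z), form z (Y z)⁆ i j = 0
  formI_bijective : ∀ z, Function.Bijective fun v => gPart (form z v)

namespace ExtrinsicCartanBundle

variable {M P} (Q : ExtrinsicCartanBundle M P)

/-- The `𝔤`-component `ω_I` of `ω`, in coordinates. -/
noncomputable def formI (z : P) (v : TangentSpace (𝓡 8) z) : Fin 8 → ℝ := gPart (Q.form z v)

/-- The `𝔤^⊥`-component `ω_II` of `ω`. -/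
noncomputable def formII (z : P) (v : TangentSpace (𝓡 8) z) : Matrix (Fin 8) (Fin 8) ℝ :=
  perpPart (Q.form z v)

/-- The vector field `Ã` on `P` with `ω_I(Ã) = A_i`, for a basis vector `A_i` of `𝔤`. -/
noncomputable def framing (i : Fin 8) (z : P) : TangentSpace (𝓡 8) z :=
  (Equiv.ofBijective (Q.formI z) (Q.formI_bijective z)).symm (Pi.single i 1)

/-- The value `χ(z)(A_i)` of the function `χ` defined by `ω_II = χ ω_I`. -/
noncomputable def χ (z : P) (i : Fin 8) : Matrix (Fin 8) (Fin 8) ℝ :=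
  Q.formII z (Q.framing i z)

/-- The restriction of `χ(z)` to `𝔤₋`. -/
noncomputable def χMinus (z : P) : Cochain := fun k => Q.χ z (eIdx k)

/-- The derivation `D_{e_k}`, along the vector field `ẽ_k` on `P` with `ω_I(ẽ_k) = e_k`. -/
noncomputable def D (k : Fin 3) (f : P → ℝ) : P → ℝ := lieD (Q.framing (eIdx k)) f

end ExtrinsicCartanBundle

/-- The normal extrinsic Cartan bundles of type `𝔰𝔩₃`: `χ` is `Hom(𝔤₋, 𝔤^⊥)`-valued (it vanishes
on `𝔤⁰ = ⟨A₁, …, A₅⟩`), `∂* χ = 0`, and `χ` has only components of positive degree. -/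
structure NormalExtrinsicCartanBundle extends ExtrinsicCartanBundle M P where
  χ_borel : ∀ z (i : Fin 8), 0 ≤ deg i → toExtrinsicCartanBundle.χ z i = 0
  χ_normal : ∀ z, codiff (toExtrinsicCartanBundle.χMinus z) = 0
  χ_positive : ∀ z (p : ℤ), p ≤ 0 → cochainPart p (toExtrinsicCartanBundle.χMinus z) = 0

end Bundles

end SL3Type

/-!
The Lie algebra `𝔩 = 𝔬(V, κ)` has dimension `28` and decomposes under `𝔤 = 𝔰𝔩(3, ℝ)` as `𝔤 ⊕ S³(ℝ³)
⊕ S³(ℝ³)*`, the last two summands forming `𝔤^⊥` (`orthAlg_eq`). In bases of weight vectors the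
brackets of `𝔩` are explicit polynomials (`lie_eq`). The fields `Ãᵢ` with `ω_I(Ãᵢ) = Aᵢ` form a
smooth global frame of `P`, and `χ` becomes a family of smooth functions `coR i · a`, `coS i · a`,
the coordinates of `χ(Aᵢ)` in the two summands.

On the frame, the `𝔤`-component of `dω + ½[ω, ω] = 0` determines the Lie brackets of the frame
fields (`formI_mlieBracket`), and the two other components become first-order equations for the
coordinates of `χ` (`structure_eq_coR`, `structure_eq_coS`). A coordinate of degree `d` at `e_k` has
homogeneous degree `d - deg e_k`, and each equation has a well-defined homogeneous degree in which
the derivative along `e_k` counts `-deg e_k`. The equations are used degree by degree: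

* In degree `1` only the algebraic part of the equations survives. With `∂* χ = 0` it kills all
  components except the coefficients of `ξ₁ᴿ` and `ξ₁ˢ` (`relations_degree_one`). This gives `h₁ᴿ`
  and `h₁ˢ`.
* In degrees `2, …, 5` all further components of `S³(ℝ³)` turn out to be multiples of a single
  function in each degree, which is proportional to the derivative along `e₁` of the one in the
  preceding degree. So `D_{e_1} h₁ᴿ, …, D_{e_1}⁴ h₁ᴿ` are, up to constants, the coordinates of the
  `S³(ℝ³)`-component of `χ(e₀)`. The same holds for `S³(ℝ³)*` with `e₂` in place of `e₁`. In degree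
  `3` the equation for the pair `e₀, e₂` expresses `D_{e_0} h₁ᴿ` by the derivative along `e₂` of
  `D_{e_1} h₁ᴿ`, and this is the second-order condition.
* In degree `6` no component of `χ` is left. The equation for `D_{e_1}⁵ h₁ᴿ` closes up, and its
  right-hand side is the quadratic expression in the other summand that comes from `[ω_II, ω_II]`
  (`relations_degree_six`).
-/

namespace SL3Type

/-! ### Coordinates on `𝔩 = 𝔤 ⊕ S³(ℝ³) ⊕ S³(ℝ³)*` -/

theorem toMat_eq (c : Fin 8 → ℝ) : toMat c =
    !![c 3, c 1, c 0; c 6, c 4 - c 3, c 2; c 7, c 5, -c 4] := by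
  ext i j
  fin_cases i <;> fin_cases j <;> simp [toMat, A, Fin.sum_univ_eight]
  ring

theorem A_eq : A = ![!![0, 0, 1; 0, 0, 0; 0, 0, 0], !![0, 1, 0; 0, 0, 0; 0, 0, 0],
    !![0, 0, 0; 0, 0, 1; 0, 0, 0], !![1, 0, 0; 0, -1, 0; 0, 0, 0], !![0, 0, 0; 0, 1, 0; 0, 0, -1],
    !![0, 0, 0; 0, 0, 0; 0, 1, 0], !![0, 0, 0; 1, 0, 0; 0, 0, 0],
    !![0, 0, 0; 0, 0, 0; 1, 0, 0]] := by
  funext k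
  fin_cases k <;> (ext i j; fin_cases i <;> fin_cases j <;> simp [A])

set_option maxHeartbeats 1000000 in
theorem adM_toMat (c : Fin 8 → ℝ) : adM (toMat c) =
  !![c 3 + c 4, -c 2, c 1, -c 0, -c 0, 0, 0, 0;
     -c 5, 2 * c 3 - c 4, 0, -2 * c 1, c 1, c 0, 0, 0;
     c 6, 0, -c 3 + 2 * c 4, c 2, -2 * c 2, 0, -c 0, 0;
     -c 7, -c 6, 0, 0, 0, 0, c 1, c 0;
     -c 7, 0, -c 5, 0, 0, c 2, 0, c 0;
     0, c 7, 0, -c 5, 2 * c 5, c 3 - 2 * c 4, 0, -c 1;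
     0, 0, -c 7, 2 * c 6, -c 6, 0, -2 * c 3 + c 4, c 2;
     0, 0, 0, c 7, c 7, -c 6, c 5, -c 3 - c 4] := by
  ext i j
  fin_cases j <;>
    simp [adM, A_eq, toMat_eq, coords] <;> fin_cases i <;> simp <;> ring_nf

theorem toMat_single (i : Fin 8) : toMat (Pi.single i 1) = A i := by
  simp [toMat]

theorem trace_adM_mul_adM (c d : Fin 8 → ℝ) : (adM (toMat c) * adM (toMat d)).trace =
    6 * (c 0 * d 7 + c 7 * d 0 + c 1 * d 6 + c 6 * d 1 + c 2 * d 5 + c 5 * d 2)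
      + 12 * c 3 * d 3 - 6 * c 3 * d 4 - 6 * c 4 * d 3 + 12 * c 4 * d 4 := by
  rw [adM_toMat, adM_toMat]
  simp only [Matrix.trace, Matrix.diag, Fin.sum_univ_eight, Matrix.mul_apply, Matrix.of_apply,
    Matrix.cons_val]
  ring

theorem killingM_eq : killingM =
  !![0, 0, 0, 0, 0, 0, 0, 6;
     0, 0, 0, 0, 0, 0, 6, 0;
     0, 0, 0, 0, 0, 6, 0, 0;
     0, 0, 0, 12, -6, 0, 0, 0;
     0, 0, 0, -6, 12, 0, 0, 0;
     0, 0, 6, 0, 0, 0, 0, 0;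
     0, 6, 0, 0, 0, 0, 0, 0;
     6, 0, 0, 0, 0, 0, 0, 0] := by
  ext i j
  rw [killingM, Matrix.of_apply, ← toMat_single, ← toMat_single, trace_adM_mul_adM]
  fin_cases i <;> fin_cases j <;> simp

theorem killingM_inv : killingM⁻¹ =
  !![0, 0, 0, 0, 0, 0, 0, 1 / 6;
     0, 0, 0, 0, 0, 0, 1 / 6, 0;
     0, 0, 0, 0, 0, 1 / 6, 0, 0;
     0, 0, 0, 1 / 9, 1 / 18, 0, 0, 0;
     0, 0, 0, 1 / 18, 1 / 9, 0, 0, 0;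
     0, 0, 1 / 6, 0, 0, 0, 0, 0;
     0, 1 / 6, 0, 0, 0, 0, 0, 0;
     1 / 6, 0, 0, 0, 0, 0, 0, 0] := by
  refine Matrix.inv_eq_right_inv ?_
  rw [killingM_eq]
  ext i j
  fin_cases i <;> fin_cases j <;> simp [Matrix.mul_apply, Fin.sum_univ_eight] <;>
    norm_num

/-- The element with coordinates `r` of the summand `S³(ℝ³)` of `𝔤^⊥ ⊂ 𝔩`, as a matrix in the basis
`A`. The coordinates refer to a basis of weight vectors; the zeroth one, `rMat (Pi.single 0 1)`, is
the highest weight vector `R_{2,1}`, and `rMat (Pi.single 5 1)` spans the weight space of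
`R_{-1,1}`. -/
def rMat (r : Fin 10 → ℝ) : Matrix (Fin 8) (Fin 8) ℝ :=
  !![-r 4, -r 3, r 2, -2 * r 1, r 1, 0, r 0, 0;
     -r 6, r 4, 0, r 2, r 2, -r 1, 0, -r 0;
     r 7, -r 5, r 4, -2 * r 3, r 3, 0, r 1, 0;
     0, 0, r 6, r 4, -2 * r 4, r 3, -r 2, r 1;
     -r 8, -r 7, r 6, 2 * r 4, -r 4, 0, -r 2, 0;
     -r 9, -r 8, 0, -r 6, -r 6, -r 4, 0, -r 2;
     0, 0, r 8, -r 7, 2 * r 7, r 5, -r 4, r 3;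
     0, 0, r 9, -r 8, 2 * r 8, -r 7, r 6, r 4]

/-- The element with coordinates `s` of the summand `S³(ℝ³)*` of `𝔤^⊥ ⊂ 𝔩`, as a matrix in the basis
`A`. The coordinates refer to a basis of weight vectors, chosen as the image of the one in `rMat`
under the diagram automorphism of `𝔰𝔩(3, ℝ)` up to sign; the zeroth one, `sMat (Pi.single 0 1)`, is
the highest weight vector `S_{1,2}`. -/
def sMat (s : Fin 10 → ℝ) : Matrix (Fin 8) (Fin 8) ℝ :=
  !![s 4, s 2, -s 3, s 1, -2 * s 1, s 0, 0, 0;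
     s 7, -s 4, s 5, -s 3, 2 * s 3, -s 1, 0, 0;
     -s 6, 0, -s 4, -s 2, -s 2, 0, s 1, -s 0;
     -s 8, -s 6, s 7, s 4, -2 * s 4, s 2, 0, 0;
     0, -s 6, 0, 2 * s 4, -s 4, s 2, -s 3, s 1;
     0, -s 8, 0, -2 * s 7, s 7, s 4, -s 5, s 3;
     -s 9, 0, s 8, s 6, s 6, 0, s 4, -s 2;
     0, s 9, 0, 2 * s 8, -s 8, s 6, -s 7, -s 4]

/-- The coordinates of the `𝔤`-component of an element of `𝔩 = 𝔤 ⊕ S³(ℝ³) ⊕ S³(ℝ³)*`. It is extended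
from `𝔩` to all `8 × 8` matrices by a choice of entries, without meaning outside `𝔩`. -/
noncomputable def gCoord : Matrix (Fin 8) (Fin 8) ℝ →ₗ[ℝ] (Fin 8 → ℝ) where
  toFun X := ![(X 0 3 + X 1 5 + 3 * X 3 7) / 3,
      (X 0 2 - X 1 3) / 3,
      (-X 0 1 - X 2 4) / 3,
      (X 0 0 + X 1 1) / 3,
      (X 0 0 + X 2 2) / 3,
      (-X 1 0 + X 5 4) / 3,
      (X 2 0 + X 6 3) / 3,
      (-3 * X 3 0 + X 5 1 - X 7 3) / 3]
  map_add' X Y := by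
    ext a
    fin_cases a <;> simp <;> ring
  map_smul' c X := by
    ext a
    fin_cases a <;> simp <;> ring

/-- The coordinates of the `S³(ℝ³)`-component of an element of `𝔩`, extended linearly to all `8 × 8`
matrices. Each coordinate reads off entries of one and the same degree, so that it respects the
grading. -/
noncomputable def rCoord : Matrix (Fin 8) (Fin 8) ℝ →ₗ[ℝ] (Fin 10 → ℝ) where
  toFun X := ![X 0 6,
      (-X 0 3 - X 1 5) / 3,
      (X 0 2 - X 1 3 - 3 * X 3 6) / 3,
      (-X 0 1 - X 2 3) / 3,
      (-X 0 0 + X 1 1 + X 2 2 + 3 * X 3 3) / 6,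
      -X 2 1,
      (-X 1 0 + 3 * X 3 2 + X 5 3) / 3,
      (X 2 0 + X 6 4) / 3,
      (-X 5 1 + X 7 4) / 3,
      -X 5 0]
  map_add' X Y := by
    ext a
    fin_cases a <;> simp <;> ring
  map_smul' c X := by
    ext a
    fin_cases a <;> simp <;> ring

/-- The coordinates of the `S³(ℝ³)*`-component of an element of `𝔩`, extended linearly to all `8 ×
8` matrices. Each coordinate reads off entries of one and the same degree. -/
noncomputable def sCoord : Matrix (Fin 8) (Fin 8) ℝ →ₗ[ℝ] (Fin 10 → ℝ) where
  toFun X := ![X 0 5,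
      (-X 0 4 - X 1 5) / 3,
      (X 0 1 + X 2 3 + 3 * X 3 5) / 3,
      (-X 0 2 + X 1 4) / 3,
      (X 0 0 - X 1 1 - X 2 2 + 3 * X 3 3) / 6,
      X 1 2,
      (-X 2 0 - 3 * X 3 1 - X 6 3) / 3,
      (X 1 0 - X 5 3) / 3,
      (-X 5 1 + X 7 3) / 3,
      -X 6 0]
  map_add' X Y := by
    ext a
    fin_cases a <;> simp <;> ring
  map_smul' c X := by
    ext a
    fin_cases a <;> simp <;> ring

set_option maxHeartbeats 1000000 in
/-- The decomposition `𝔩 = 𝔤 ⊕ S³(ℝ³) ⊕ S³(ℝ³)*`, in coordinates. The `36` linear equations for an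
element of `𝔬(V, κ)` cut out a space of dimension `28 = 8 + 10 + 10`. -/
theorem orthAlg_eq {X : Matrix (Fin 8) (Fin 8) ℝ} (hX : X ∈ orthAlg) :
    X = adM (toMat (gCoord X)) + rMat (rCoord X) + sMat (sCoord X) := by
  have h : ∀ i j, (Xᵀ * killingM + killingM * X) i j = 0 := fun i j => by
    rw [show Xᵀ * killingM + killingM * X = 0 from hX]
    rfl
  rw [killingM_eq] at h
  simp only [Matrix.add_apply, Matrix.mul_apply, Fin.sum_univ_eight, Matrix.transpose_apply] at h
  have h00 := h 0 0
  have h01 := h 0 1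
  have h02 := h 0 2
  have h03 := h 0 3
  have h04 := h 0 4
  have h05 := h 0 5
  have h06 := h 0 6
  have h07 := h 0 7
  have h11 := h 1 1
  have h12 := h 1 2
  have h13 := h 1 3
  have h14 := h 1 4
  have h15 := h 1 5
  have h16 := h 1 6
  have h17 := h 1 7
  have h22 := h 2 2
  have h23 := h 2 3
  have h24 := h 2 4
  have h25 := h 2 5
  have h26 := h 2 6
  have h27 := h 2 7
  have h33 := h 3 3
  have h34 := h 3 4
  have h35 := h 3 5
  have h36 := h 3 6
  have h37 := h 3 7
  have h44 := h 4 4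
  have h45 := h 4 5
  have h46 := h 4 6
  have h47 := h 4 7
  have h55 := h 5 5
  have h56 := h 5 6
  have h57 := h 5 7
  have h66 := h 6 6
  have h67 := h 6 7
  have h77 := h 7 7
  simp at h00 h01 h02 h03 h04 h05 h06 h07 h11 h12 h13 h14 h15 h16 h17 h22 h23 h24 h25 h26 h27
  simp at h33 h34 h35 h36 h37 h44 h45 h46 h47 h55 h56 h57 h66 h67 h77
  -- The coordinates are kept opaque; only the equations defining them enter the linear algebra.
  generalize hg : gCoord X = c
  generalize hr : rCoord X = r
  generalize hs : sCoord X = s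
  have g0 : c 0 = (X 0 3 + X 1 5 + 3 * X 3 7) / 3 := by simp [← hg, gCoord]
  have g1 : c 1 = (X 0 2 - X 1 3) / 3 := by simp [← hg, gCoord]
  have g2 : c 2 = (-X 0 1 - X 2 4) / 3 := by simp [← hg, gCoord]
  have g3 : c 3 = (X 0 0 + X 1 1) / 3 := by simp [← hg, gCoord]
  have g4 : c 4 = (X 0 0 + X 2 2) / 3 := by simp [← hg, gCoord]
  have g5 : c 5 = (-X 1 0 + X 5 4) / 3 := by simp [← hg, gCoord]
  have g6 : c 6 = (X 2 0 + X 6 3) / 3 := by simp [← hg, gCoord]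
  have g7 : c 7 = (-3 * X 3 0 + X 5 1 - X 7 3) / 3 := by simp [← hg, gCoord]
  have r0 : r 0 = X 0 6 := by simp [← hr, rCoord]
  have r1 : r 1 = (-X 0 3 - X 1 5) / 3 := by simp [← hr, rCoord]
  have r2 : r 2 = (X 0 2 - X 1 3 - 3 * X 3 6) / 3 := by simp [← hr, rCoord]
  have r3 : r 3 = (-X 0 1 - X 2 3) / 3 := by simp [← hr, rCoord]
  have r4 : r 4 = (-X 0 0 + X 1 1 + X 2 2 + 3 * X 3 3) / 6 := by simp [← hr, rCoord]
  have r5 : r 5 = -X 2 1 := by simp [← hr, rCoord]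
  have r6 : r 6 = (-X 1 0 + 3 * X 3 2 + X 5 3) / 3 := by simp [← hr, rCoord]
  have r7 : r 7 = (X 2 0 + X 6 4) / 3 := by simp [← hr, rCoord]
  have r8 : r 8 = (-X 5 1 + X 7 4) / 3 := by simp [← hr, rCoord]
  have r9 : r 9 = -X 5 0 := by simp [← hr, rCoord]
  have s0 : s 0 = X 0 5 := by simp [← hs, sCoord]
  have s1 : s 1 = (-X 0 4 - X 1 5) / 3 := by simp [← hs, sCoord]
  have s2 : s 2 = (X 0 1 + X 2 3 + 3 * X 3 5) / 3 := by simp [← hs, sCoord]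
  have s3 : s 3 = (-X 0 2 + X 1 4) / 3 := by simp [← hs, sCoord]
  have s4 : s 4 = (X 0 0 - X 1 1 - X 2 2 + 3 * X 3 3) / 6 := by simp [← hs, sCoord]
  have s5 : s 5 = X 1 2 := by simp [← hs, sCoord]
  have s6 : s 6 = (-X 2 0 - 3 * X 3 1 - X 6 3) / 3 := by simp [← hs, sCoord]
  have s7 : s 7 = (X 1 0 - X 5 3) / 3 := by simp [← hs, sCoord]
  have s8 : s 8 = (-X 5 1 + X 7 3) / 3 := by simp [← hs, sCoord]
  have s9 : s 9 = -X 6 0 := by simp [← hs, sCoord]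
  clear h hg hr hs
  rw [adM_toMat]
  ext i j
  fin_cases i <;> fin_cases j <;>
    simp only [rMat, sMat, Matrix.add_apply, Matrix.of_apply, Matrix.cons_val,
      Fin.zero_eta, Fin.mk_one, Fin.reduceFinMk, Fin.isValue]
  · linarith only [g3, g4, r4, s4]
  · linarith only [g2, r3, s2, h35, h45]
  · linarith only [g1, r2, s3, h36, h46]
  · linarith only [g0, r1, s1, h37, h47]
  · linarith only [g0, r1, s1, h37, h47]
  · linarith only [s0]
  · linarith only [r0]
  · linarith only [h77]
  · linarith only [g5, r6, s7, h23, h24]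
  · linarith only [g3, g4, r4, s4]
  · linarith only [s5]
  · linarith only [g1, r2, s3, h36, h46]
  · linarith only [g1, r2, s3, h36, h46]
  · linarith only [g0, r1, s1, h37, h47]
  · linarith only [h66]
  · linarith only [r0, h67]
  · linarith only [g6, r7, s6, h13, h14]
  · linarith only [r5]
  · linarith only [g3, g4, r4, s4]
  · linarith only [g2, r3, s2, h35, h45]
  · linarith only [g2, r3, s2, h35, h45]
  · linarith only [h55]
  · linarith only [g0, r1, s1, h37, h47, h56]
  · linarith only [s0, h57]
  · linarith only [g7, s8]
  · linarith only [g6, s6]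
  · linarith only [r6, s7]
  · linarith only [r4, s4]
  · linarith only [r4, s4, h33, h34, h44]
  · linarith only [r3, s2]
  · linarith only [g1, r2]
  · linarith only [g0, r1]
  · linarith only [g7, r8, h03, h04]
  · linarith only [r7, s6, h13, h14]
  · linarith only [g5, r6, h23, h24]
  · linarith only [r4, s4, h33]
  · linarith only [r4, s4, h33, h34, h44]
  · linarith only [g2, s2, h35, h45]
  · linarith only [r2, s3, h36, h46]
  · linarith only [g0, s1, h37, h47]
  · linarith only [r9]
  · linarith only [g7, r8, s8, h03, h04]
  · linarith only [h22]
  · linarith only [g5, r6, s7, h23, h24]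
  · linarith only [g5, r6, s7, h23, h24]
  · linarith only [g3, g4, r4, s4, h25]
  · linarith only [s5, h26]
  · linarith only [g1, r2, s3, h27, h36, h46]
  · linarith only [s9]
  · linarith only [h11]
  · linarith only [g7, r8, s8, h03, h04, h12]
  · linarith only [g6, r7, s6, h13, h14]
  · linarith only [g6, r7, s6, h13, h14]
  · linarith only [r5, h15]
  · linarith only [g3, g4, r4, s4, h16]
  · linarith only [g2, r3, s2, h17, h35, h45]
  · linarith only [h00]
  · linarith only [s9, h01]
  · linarith only [r9, h02]
  · linarith only [g7, r8, s8, h03, h04]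
  · linarith only [g7, r8, s8, h03, h04]
  · linarith only [g6, r7, s6, h05, h13, h14]
  · linarith only [g5, r6, s7, h06, h23, h24]
  · linarith only [g3, g4, r4, s4, h07]

section

variable (c : Fin 8 → ℝ) (r s : Fin 10 → ℝ)

theorem gCoord_add : gCoord (adM (toMat c) + rMat r + sMat s) = c := by
  rw [adM_toMat]
  ext k
  fin_cases k <;>
    simp only [gCoord, LinearMap.coe_mk, AddHom.coe_mk, Matrix.cons_val, Fin.zero_eta, Fin.mk_one,
      Fin.reduceFinMk, Fin.isValue, rMat, sMat, Matrix.add_apply, Matrix.of_apply] <;> ring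

theorem rCoord_add : rCoord (adM (toMat c) + rMat r + sMat s) = r := by
  rw [adM_toMat]
  ext k
  fin_cases k <;>
    simp only [rCoord, LinearMap.coe_mk, AddHom.coe_mk, Matrix.cons_val, Fin.zero_eta, Fin.mk_one,
      Fin.reduceFinMk, Fin.isValue, rMat, sMat, Matrix.add_apply, Matrix.of_apply] <;> ring

theorem sCoord_add : sCoord (adM (toMat c) + rMat r + sMat s) = s := by
  rw [adM_toMat]
  ext k
  fin_cases k <;>
    simp only [sCoord, LinearMap.coe_mk, AddHom.coe_mk, Matrix.cons_val, Fin.zero_eta, Fin.mk_one,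
      Fin.reduceFinMk, Fin.isValue, rMat, sMat, Matrix.add_apply, Matrix.of_apply] <;> ring

theorem trace_rMat_mul_adM : (rMat r * adM (toMat c)).trace = 0 := by
  rw [adM_toMat]
  simp only [Matrix.trace, Matrix.diag, Fin.sum_univ_eight, Matrix.mul_apply, rMat, Matrix.of_apply,
    Matrix.cons_val]
  ring

theorem trace_sMat_mul_adM : (sMat s * adM (toMat c)).trace = 0 := by
  rw [adM_toMat]
  simp only [Matrix.trace, Matrix.diag, Fin.sum_univ_eight, Matrix.mul_apply, sMat, Matrix.of_apply,
    Matrix.cons_val]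
  ring

end

/-- The summands `S³(ℝ³)` and `S³(ℝ³)*` are orthogonal to `𝔤` for the trace form, hence `gPart` is
the first coordinate of the decomposition. -/
theorem gPart_add (c : Fin 8 → ℝ) (r s : Fin 10 → ℝ) :
    gPart (adM (toMat c) + rMat r + sMat s) = c := by
  have h : (fun i => ((adM (toMat c) + rMat r + sMat s) * adM (A i)).trace) =
      fun i => (adM (toMat c) * adM (toMat (Pi.single i 1))).trace := by
    funext i
    rw [add_mul, add_mul, Matrix.trace_add, Matrix.trace_add, ← toMat_single, trace_rMat_mul_adM,
      trace_sMat_mul_adM, add_zero, add_zero]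
  rw [gPart, h, killingM_inv]
  simp only [trace_adM_mul_adM]
  ext k
  fin_cases k <;> simp [Matrix.mulVec, dotProduct, Fin.sum_univ_eight, Pi.single_apply] <;> ring

theorem gPart_eq {X : Matrix (Fin 8) (Fin 8) ℝ} (hX : X ∈ orthAlg) : gPart X = gCoord X := by
  conv_lhs => rw [orthAlg_eq hX, gPart_add]

/-! ### The brackets of the summands of `𝔩` -/

/-- The bracket of `𝔰𝔩(3, ℝ)` in the basis `A`. -/
noncomputable def gBracket (c d : Fin 8 → ℝ) : Fin 8 → ℝ :=
  ![-c 0 * d 3 - c 0 * d 4 + c 1 * d 2 - c 2 * d 1 + c 3 * d 0 + c 4 * d 0,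
    c 0 * d 5 - 2 * c 1 * d 3 + c 1 * d 4 + 2 * c 3 * d 1 - c 4 * d 1 - c 5 * d 0,
    -c 0 * d 6 + c 2 * d 3 - 2 * c 2 * d 4 - c 3 * d 2 + 2 * c 4 * d 2 + c 6 * d 0,
    c 0 * d 7 + c 1 * d 6 - c 6 * d 1 - c 7 * d 0,
    c 0 * d 7 + c 2 * d 5 - c 5 * d 2 - c 7 * d 0,
    -c 1 * d 7 + c 3 * d 5 - 2 * c 4 * d 5 - c 5 * d 3 + 2 * c 5 * d 4 + c 7 * d 1,
    c 2 * d 7 - 2 * c 3 * d 6 + c 4 * d 6 + 2 * c 6 * d 3 - c 6 * d 4 - c 7 * d 2,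
    -c 3 * d 7 - c 4 * d 7 + c 5 * d 6 - c 6 * d 5 + c 7 * d 3 + c 7 * d 4]

/-- The action of `𝔰𝔩(3, ℝ)` on `S³(ℝ³)`, in the coordinates of `rMat`. -/
noncomputable def actR (c : Fin 8 → ℝ) (r : Fin 10 → ℝ) : Fin 10 → ℝ :=
  ![3 * c 0 * r 2 + 3 * c 1 * r 1 + 3 * c 3 * r 0,
    2 * c 0 * r 4 + 2 * c 1 * r 3 + c 2 * r 2 + c 3 * r 1 + c 4 * r 1 + c 6 * r 0,
    -2 * c 0 * r 6 + 2 * c 1 * r 4 + 2 * c 3 * r 2 - c 4 * r 2 + c 5 * r 1 + c 7 * r 0,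
    -c 0 * r 7 + c 1 * r 5 + 2 * c 2 * r 4 - c 3 * r 3 + 2 * c 4 * r 3 + 2 * c 6 * r 1,
    -c 0 * r 8 - c 1 * r 7 - c 2 * r 6 + c 5 * r 3 + c 6 * r 2 + c 7 * r 1,
    -3 * c 2 * r 7 - 3 * c 3 * r 5 + 3 * c 4 * r 5 + 3 * c 6 * r 3,
    c 0 * r 9 + c 1 * r 8 + c 3 * r 6 - 2 * c 4 * r 6 - 2 * c 5 * r 4 - 2 * c 7 * r 2,
    2 * c 2 * r 8 - 2 * c 3 * r 7 + c 4 * r 7 - c 5 * r 5 - 2 * c 6 * r 4 - c 7 * r 3,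
    c 2 * r 9 - c 3 * r 8 - c 4 * r 8 + 2 * c 5 * r 7 + c 6 * r 6 - 2 * c 7 * r 4,
    -3 * c 4 * r 9 + 3 * c 5 * r 8 + 3 * c 7 * r 6]

/-- The action of `𝔰𝔩(3, ℝ)` on `S³(ℝ³)*`, in the coordinates of `sMat`. -/
noncomputable def actS (c : Fin 8 → ℝ) (s : Fin 10 → ℝ) : Fin 10 → ℝ :=
  ![-3 * c 0 * s 2 + 3 * c 2 * s 1 + 3 * c 4 * s 0,
    -2 * c 0 * s 4 + c 1 * s 2 + 2 * c 2 * s 3 + c 3 * s 1 + c 4 * s 1 + c 5 * s 0,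
    2 * c 0 * s 6 + 2 * c 2 * s 4 - c 3 * s 2 + 2 * c 4 * s 2 + c 6 * s 1 - c 7 * s 0,
    c 0 * s 7 + 2 * c 1 * s 4 + c 2 * s 5 + 2 * c 3 * s 3 - c 4 * s 3 + 2 * c 5 * s 1,
    c 0 * s 8 - c 1 * s 6 - c 2 * s 7 + c 5 * s 2 + c 6 * s 3 - c 7 * s 1,
    -3 * c 1 * s 7 + 3 * c 3 * s 5 - 3 * c 4 * s 5 + 3 * c 5 * s 3,
    -c 0 * s 9 + c 2 * s 8 - 2 * c 3 * s 6 + c 4 * s 6 - 2 * c 6 * s 4 + 2 * c 7 * s 2,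
    2 * c 1 * s 8 + c 3 * s 7 - 2 * c 4 * s 7 - 2 * c 5 * s 4 - c 6 * s 5 + c 7 * s 3,
    c 1 * s 9 - c 3 * s 8 - c 4 * s 8 + c 5 * s 6 + 2 * c 6 * s 7 + 2 * c 7 * s 4,
    -3 * c 3 * s 9 + 3 * c 6 * s 8 - 3 * c 7 * s 6]

/-- The equivariant alternating map `Λ² S³(ℝ³) → S³(ℝ³)*`, in the coordinates of `rMat` and `sMat`.
Up to sign, the same formula gives `Λ² S³(ℝ³)* → S³(ℝ³)`. -/
noncomputable def perpBracket (r q : Fin 10 → ℝ) : Fin 10 → ℝ :=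
  ![r 0 * q 5 - 3 * r 1 * q 3 + 3 * r 3 * q 1 - r 5 * q 0,
    -r 0 * q 7 - 2 * r 1 * q 4 - r 2 * q 3 + r 3 * q 2 + 2 * r 4 * q 1 + r 7 * q 0,
    -r 1 * q 7 - r 2 * q 5 - 2 * r 3 * q 4 + 2 * r 4 * q 3 + r 5 * q 2 + r 7 * q 1,
    -r 0 * q 8 + r 1 * q 6 - 2 * r 2 * q 4 + 2 * r 4 * q 2 - r 6 * q 1 + r 8 * q 0,
    -r 1 * q 8 + r 2 * q 7 + r 3 * q 6 - r 6 * q 3 - r 7 * q 2 + r 8 * q 1,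
    -r 0 * q 9 + 3 * r 2 * q 6 - 3 * r 6 * q 2 + r 9 * q 0,
    r 3 * q 8 - 2 * r 4 * q 7 - r 5 * q 6 + r 6 * q 5 + 2 * r 7 * q 4 - r 8 * q 3,
    r 1 * q 9 - r 2 * q 8 - 2 * r 4 * q 6 + 2 * r 6 * q 4 + r 8 * q 2 - r 9 * q 1,
    r 3 * q 9 - 2 * r 4 * q 8 - r 6 * q 7 + r 7 * q 6 + 2 * r 8 * q 4 - r 9 * q 3,
    r 5 * q 9 + 3 * r 7 * q 8 - 3 * r 8 * q 7 - r 9 * q 5]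

/-- The equivariant map `S³(ℝ³) ⊗ S³(ℝ³)* → 𝔰𝔩(3, ℝ)` given by the bracket of `𝔩`, in coordinates.
-/
noncomputable def perpPairing (r s : Fin 10 → ℝ) : Fin 8 → ℝ :=
  ![-r 0 * s 6 - 2 * r 1 * s 4 + 2 * r 2 * s 2 + r 3 * s 3 - 2 * r 4 * s 1 - r 6 * s 0,
    r 0 * s 8 - 2 * r 1 * s 7 - 2 * r 2 * s 4 - r 3 * s 5 + 2 * r 4 * s 3 + r 6 * s 1,
    -r 1 * s 6 - 2 * r 3 * s 4 + 2 * r 4 * s 2 + r 5 * s 3 + 2 * r 7 * s 1 - r 8 * s 0,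
    -2 / 3 * r 0 * s 9 + r 1 * s 8 - r 2 * s 6 + 1 / 3 * r 5 * s 5 +
      r 7 * s 3 - r 8 * s 1 + 1 / 3 * r 9 * s 0,
    -1 / 3 * r 0 * s 9 + r 1 * s 8 - r 3 * s 7 - 1 / 3 * r 5 * s 5 +
      r 6 * s 2 - r 8 * s 1 + 2 / 3 * r 9 * s 0,
    r 2 * s 8 - 2 * r 4 * s 7 + 2 * r 6 * s 4 + r 7 * s 5 - 2 * r 8 * s 3 + r 9 * s 1,
    -r 1 * s 9 + 2 * r 3 * s 8 - 2 * r 4 * s 6 - r 5 * s 7 + 2 * r 7 * s 4 - r 8 * s 2,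
    -r 2 * s 9 + 2 * r 4 * s 8 + 2 * r 6 * s 6 + r 7 * s 7 + 2 * r 8 * s 4 - r 9 * s 2]

set_option maxHeartbeats 4000000 in
theorem lie_adM_rMat (c : Fin 8 → ℝ) (r : Fin 10 → ℝ) :
    ⁅adM (toMat c), rMat r⁆ = rMat (actR c r) := by
  -- The coordinates of the right-hand side are named first, so that their large expressions are
  -- substituted only after both sides have been reduced to a single entry.
  generalize hv : actR c r = v
  obtain ⟨h0, h1, h2, h3, h4, h5, h6, h7, h8, h9⟩ :
      v 0 = actR c r 0 ∧ v 1 = actR c r 1 ∧ v 2 = actR c r 2 ∧ v 3 = actR c r 3 ∧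
      v 4 = actR c r 4 ∧ v 5 = actR c r 5 ∧ v 6 = actR c r 6 ∧ v 7 = actR c r 7 ∧
      v 8 = actR c r 8 ∧ v 9 = actR c r 9 := by
    simp [← hv]
  simp only [actR, Matrix.cons_val] at h0 h1 h2 h3 h4 h5 h6 h7 h8 h9
  rw [Ring.lie_def, adM_toMat]
  ext i j
  fin_cases i <;> fin_cases j <;>
    simp only [rMat, Matrix.sub_apply, Matrix.mul_apply, Fin.sum_univ_eight, Matrix.of_apply,
      Matrix.cons_val, Fin.zero_eta, Fin.mk_one, Fin.reduceFinMk, Fin.isValue, h0, h1, h2, h3, h4,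
      h5, h6, h7, h8, h9] <;>
    ring

set_option maxHeartbeats 4000000 in
theorem lie_adM_sMat (c : Fin 8 → ℝ) (s : Fin 10 → ℝ) :
    ⁅adM (toMat c), sMat s⁆ = sMat (actS c s) := by
  generalize hv : actS c s = v
  obtain ⟨h0, h1, h2, h3, h4, h5, h6, h7, h8, h9⟩ :
      v 0 = actS c s 0 ∧ v 1 = actS c s 1 ∧ v 2 = actS c s 2 ∧ v 3 = actS c s 3 ∧
      v 4 = actS c s 4 ∧ v 5 = actS c s 5 ∧ v 6 = actS c s 6 ∧ v 7 = actS c s 7 ∧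
      v 8 = actS c s 8 ∧ v 9 = actS c s 9 := by
    simp [← hv]
  simp only [actS, Matrix.cons_val] at h0 h1 h2 h3 h4 h5 h6 h7 h8 h9
  rw [Ring.lie_def, adM_toMat]
  ext i j
  fin_cases i <;> fin_cases j <;>
    simp only [sMat, Matrix.sub_apply, Matrix.mul_apply, Fin.sum_univ_eight, Matrix.of_apply,
      Matrix.cons_val, Fin.zero_eta, Fin.mk_one, Fin.reduceFinMk, Fin.isValue, h0, h1, h2, h3, h4,
      h5, h6, h7, h8, h9] <;>
    ring

set_option maxHeartbeats 4000000 in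
theorem lie_rMat_rMat (r q : Fin 10 → ℝ) :
    ⁅rMat r, rMat q⁆ = sMat (perpBracket r q) := by
  generalize hv : perpBracket r q = v
  obtain ⟨h0, h1, h2, h3, h4, h5, h6, h7, h8, h9⟩ :
      v 0 = perpBracket r q 0 ∧ v 1 = perpBracket r q 1 ∧ v 2 = perpBracket r q 2 ∧
      v 3 = perpBracket r q 3 ∧ v 4 = perpBracket r q 4 ∧ v 5 = perpBracket r q 5 ∧
      v 6 = perpBracket r q 6 ∧ v 7 = perpBracket r q 7 ∧ v 8 = perpBracket r q 8 ∧
      v 9 = perpBracket r q 9 := by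
    simp [← hv]
  simp only [perpBracket, Matrix.cons_val] at h0 h1 h2 h3 h4 h5 h6 h7 h8 h9
  rw [Ring.lie_def]
  ext i j
  fin_cases i <;> fin_cases j <;>
    simp only [rMat, sMat, Matrix.sub_apply, Matrix.mul_apply, Fin.sum_univ_eight, Matrix.of_apply,
      Matrix.cons_val, Fin.zero_eta, Fin.mk_one, Fin.reduceFinMk, Fin.isValue, h0, h1, h2, h3, h4,
      h5, h6, h7, h8, h9] <;>
    ring

set_option maxHeartbeats 4000000 in
theorem lie_sMat_sMat (s w : Fin 10 → ℝ) :
    ⁅sMat s, sMat w⁆ = rMat (-perpBracket s w) := by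
  generalize hv : perpBracket s w = v
  obtain ⟨h0, h1, h2, h3, h4, h5, h6, h7, h8, h9⟩ :
      v 0 = perpBracket s w 0 ∧ v 1 = perpBracket s w 1 ∧ v 2 = perpBracket s w 2 ∧
      v 3 = perpBracket s w 3 ∧ v 4 = perpBracket s w 4 ∧ v 5 = perpBracket s w 5 ∧
      v 6 = perpBracket s w 6 ∧ v 7 = perpBracket s w 7 ∧ v 8 = perpBracket s w 8 ∧
      v 9 = perpBracket s w 9 := by
    simp [← hv]
  simp only [perpBracket, Matrix.cons_val] at h0 h1 h2 h3 h4 h5 h6 h7 h8 h9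
  rw [Ring.lie_def]
  ext i j
  fin_cases i <;> fin_cases j <;>
    simp only [rMat, sMat, Pi.neg_apply, Matrix.sub_apply, Matrix.mul_apply, Fin.sum_univ_eight,
      Matrix.of_apply, Matrix.cons_val, Fin.zero_eta, Fin.mk_one, Fin.reduceFinMk, Fin.isValue, h0,
      h1, h2, h3, h4, h5, h6, h7, h8, h9] <;>
    ring

set_option maxHeartbeats 4000000 in
theorem lie_rMat_sMat (r s : Fin 10 → ℝ) :
    ⁅rMat r, sMat s⁆ = adM (toMat (perpPairing r s)) := by
  generalize hv : perpPairing r s = v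
  obtain ⟨h0, h1, h2, h3, h4, h5, h6, h7⟩ :
      v 0 = perpPairing r s 0 ∧ v 1 = perpPairing r s 1 ∧ v 2 = perpPairing r s 2 ∧
      v 3 = perpPairing r s 3 ∧ v 4 = perpPairing r s 4 ∧ v 5 = perpPairing r s 5 ∧
      v 6 = perpPairing r s 6 ∧ v 7 = perpPairing r s 7 := by
    simp [← hv]
  simp only [perpPairing, Matrix.cons_val] at h0 h1 h2 h3 h4 h5 h6 h7
  rw [Ring.lie_def, adM_toMat]
  ext i j
  fin_cases i <;> fin_cases j <;>
    simp only [rMat, sMat, Matrix.sub_apply, Matrix.mul_apply, Fin.sum_univ_eight, Matrix.of_apply,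
      Matrix.cons_val, Fin.zero_eta, Fin.mk_one, Fin.reduceFinMk, Fin.isValue, h0, h1, h2, h3, h4,
      h5, h6, h7] <;>
    ring

set_option maxHeartbeats 4000000 in
theorem lie_adM_adM (c d : Fin 8 → ℝ) :
    ⁅adM (toMat c), adM (toMat d)⁆ = adM (toMat (gBracket c d)) := by
  generalize hv : gBracket c d = v
  obtain ⟨h0, h1, h2, h3, h4, h5, h6, h7⟩ :
      v 0 = gBracket c d 0 ∧ v 1 = gBracket c d 1 ∧ v 2 = gBracket c d 2 ∧
      v 3 = gBracket c d 3 ∧ v 4 = gBracket c d 4 ∧ v 5 = gBracket c d 5 ∧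
      v 6 = gBracket c d 6 ∧ v 7 = gBracket c d 7 := by
    simp [← hv]
  simp only [gBracket, Matrix.cons_val] at h0 h1 h2 h3 h4 h5 h6 h7
  rw [Ring.lie_def, adM_toMat, adM_toMat, adM_toMat]
  ext i j
  fin_cases i <;> fin_cases j <;>
    simp only [Matrix.sub_apply, Matrix.mul_apply, Fin.sum_univ_eight, Matrix.of_apply,
      Matrix.cons_val, Fin.zero_eta, Fin.mk_one, Fin.reduceFinMk, Fin.isValue, h0, h1, h2, h3, h4,
      h5, h6, h7] <;>
    ring

/-! ### Smooth functions on `P` and the framing -/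

section

variable {P : Type*} [TopologicalSpace P] [ChartedSpace (EuclideanSpace ℝ (Fin 8)) P]

theorem contMDiffAt_det {n : ℕ} {B : P → Matrix (Fin n) (Fin n) ℝ} {z : P}
    (hB : ∀ i j, ContMDiffAt (𝓡 8) 𝓘(ℝ, ℝ) ∞ (fun y => B y i j) z) :
    ContMDiffAt (𝓡 8) 𝓘(ℝ, ℝ) ∞ (fun y => (B y).det) z := by
  simp only [Matrix.det_apply']
  exact contMDiffAt_finsetSum fun σ _ =>
    contMDiffAt_const.mul (contMDiffAt_finsetProd fun i _ => hB _ _)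

theorem contMDiffAt_inv_apply {n : ℕ} {B : P → Matrix (Fin n) (Fin n) ℝ} {z : P}
    (hB : ∀ i j, ContMDiffAt (𝓡 8) 𝓘(ℝ, ℝ) ∞ (fun y => B y i j) z) (hz : (B z).det ≠ 0)
    (i j : Fin n) : ContMDiffAt (𝓡 8) 𝓘(ℝ, ℝ) ∞ (fun y => (B y)⁻¹ i j) z := by
  simp only [Matrix.inv_def, Ring.inverse_eq_inv', Matrix.smul_apply, smul_eq_mul,
    Matrix.adjugate_apply]
  refine ((contMDiffAt_det hB).inv₀ hz).mul (contMDiffAt_det fun k l => ?_)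
  by_cases hk : k = j
  · subst hk
    simpa using contMDiffAt_const
  · simpa [Matrix.updateRow_ne hk] using hB k l

theorem lieD_const (X : (z : P) → TangentSpace (𝓡 8) z) (c : ℝ) (z : P) :
    lieD X (fun _ => c) z = 0 :=
  DFunLike.congr_fun (hasMFDerivAt_const (I := 𝓡 8) (I' := 𝓘(ℝ, ℝ)) c z).mfderiv (X z)

theorem lieD_add {X : (z : P) → TangentSpace (𝓡 8) z} {f g : P → ℝ} {z : P}
    (hf : MDifferentiableAt (𝓡 8) 𝓘(ℝ, ℝ) f z) (hg : MDifferentiableAt (𝓡 8) 𝓘(ℝ, ℝ) g z) :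
    lieD X (fun y => f y + g y) z = lieD X f z + lieD X g z :=
  DFunLike.congr_fun (hf.hasMFDerivAt.add hg.hasMFDerivAt).mfderiv (X z)

theorem lieD_const_mul {X : (z : P) → TangentSpace (𝓡 8) z} {f : P → ℝ} {z : P}
    (hf : MDifferentiableAt (𝓡 8) 𝓘(ℝ, ℝ) f z) (c : ℝ) :
    lieD X (fun y => c * f y) z = c * lieD X f z :=
  DFunLike.congr_fun (hf.hasMFDerivAt.const_smul c).mfderiv (X z)

theorem mdifferentiableAt_const_mul {f : P → ℝ} {z : P}
    (hf : MDifferentiableAt (𝓡 8) 𝓘(ℝ, ℝ) f z) (c : ℝ) :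
    MDifferentiableAt (𝓡 8) 𝓘(ℝ, ℝ) (fun y => c * f y) z :=
  hf.const_smul c

theorem lieD_sum_mul {ι : Type*} (s : Finset ι) {X : (z : P) → TangentSpace (𝓡 8) z}
    {f : ι → P → ℝ} {z : P} (hf : ∀ i, MDifferentiableAt (𝓡 8) 𝓘(ℝ, ℝ) (f i) z) (c : ι → ℝ) :
    MDifferentiableAt (𝓡 8) 𝓘(ℝ, ℝ) (fun y => ∑ i ∈ s, c i * f i y) z ∧
      lieD X (fun y => ∑ i ∈ s, c i * f i y) z = ∑ i ∈ s, c i * lieD X (f i) z := by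
  classical
  induction s using Finset.induction_on with
  | empty => exact ⟨mdifferentiableAt_const, by simpa using lieD_const X 0 z⟩
  | insert a s ha ih =>
    simp only [Finset.sum_insert ha]
    have h1 := mdifferentiableAt_const_mul (hf a) (c a)
    exact ⟨h1.add ih.1, by rw [lieD_add h1 ih.1, ih.2, lieD_const_mul (hf a)]⟩

theorem linearMap_eq_sum (L : Matrix (Fin 8) (Fin 8) ℝ →ₗ[ℝ] ℝ) (X : Matrix (Fin 8) (Fin 8) ℝ) :
    L X = ∑ p : Fin 8 × Fin 8, L (Matrix.single p.1 p.2 1) * X p.1 p.2 := by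
  conv_lhs => rw [Matrix.matrix_eq_sum_single X]
  simp only [map_sum, Fintype.sum_prod_type]
  refine Finset.sum_congr rfl fun i _ => Finset.sum_congr rfl fun j _ => ?_
  rw [mul_comm, ← smul_eq_mul, ← map_smul, Matrix.smul_single, smul_eq_mul, mul_one]

/-- A derivative along a vector field commutes with a fixed linear functional of a matrix-valued
function. The entries are differentiated one by one, as in the structure equation. -/
theorem lieD_linear {X : (z : P) → TangentSpace (𝓡 8) z} {F : P → Matrix (Fin 8) (Fin 8) ℝ} {z : P}
    (hF : ∀ i j, MDifferentiableAt (𝓡 8) 𝓘(ℝ, ℝ) (fun y => F y i j) z)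
    (L : Matrix (Fin 8) (Fin 8) ℝ →ₗ[ℝ] ℝ) :
    lieD X (fun y => L (F y)) z = L (Matrix.of fun i j => lieD X (fun y => F y i j) z) := by
  rw [linearMap_eq_sum L (Matrix.of _), funext fun y => linearMap_eq_sum L (F y)]
  exact (lieD_sum_mul Finset.univ (fun p : Fin 8 × Fin 8 => hF p.1 p.2) _).2

theorem contMDiffAt_linear {F : P → Matrix (Fin 8) (Fin 8) ℝ} {z : P}
    (hF : ∀ i j, ContMDiffAt (𝓡 8) 𝓘(ℝ, ℝ) ∞ (fun y => F y i j) z)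
    (L : Matrix (Fin 8) (Fin 8) ℝ →ₗ[ℝ] ℝ) :
    ContMDiffAt (𝓡 8) 𝓘(ℝ, ℝ) ∞ (fun y => L (F y)) z := by
  rw [funext fun y => linearMap_eq_sum L (F y)]
  exact contMDiffAt_finsetSum fun (p : Fin 8 × Fin 8) _ => contMDiffAt_const.mul (hF p.1 p.2)

end

section

variable {M P : Type*} [TopologicalSpace M] [ChartedSpace (EuclideanSpace ℝ (Fin 3)) M]
  [TopologicalSpace P] [ChartedSpace (EuclideanSpace ℝ (Fin 8)) P]
  [IsManifold (𝓡 8) ∞ P]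

namespace ExtrinsicCartanBundle
variable (Q : ExtrinsicCartanBundle M P)

theorem formI_eq (z : P) (v : TangentSpace (𝓡 8) z) : Q.formI z v = gCoord (Q.form z v) :=
  gPart_eq (Q.form_mem z v)

theorem formI_framing (i : Fin 8) (z : P) : Q.formI z (Q.framing i z) = Pi.single i 1 :=
  (Equiv.ofBijective (Q.formI z) (Q.formI_bijective z)).apply_symm_apply _

theorem smooth_form_field {X : (z : P) → TangentSpace (𝓡 8) z} {z : P}
    (hX : ContMDiffAt (𝓡 8) (𝓡 8).tangent ∞
      (fun z => (⟨z, X z⟩ : TangentBundle (𝓡 8) P)) z) (i j : Fin 8) :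
    ContMDiffAt (𝓡 8) 𝓘(ℝ, ℝ) ∞ (fun y => Q.form y (X y) i j) z :=
  (Q.smooth_form i j).contMDiffAt.comp z hX

/-- The fields with constant `ω_I` are smooth. In a local frame of the tangent bundle `ω_I` has a
smooth matrix `B`, invertible by the bijectivity of `ω_I`, and the coefficients of the field are a
column of `B⁻¹`. -/
theorem isSmoothField_framing (i : Fin 8) : IsSmoothField (Q.framing i) := by
  intro z
  let e := trivializationAt (EuclideanSpace ℝ (Fin 8)) (TangentSpace (𝓡 8) : P → Type _) z
  let b := (EuclideanSpace.basisFun (Fin 8) ℝ).toBasis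
  have hz : z ∈ e.baseSet := FiberBundle.mem_baseSet_trivializationAt' z
  have hs : ∀ j, ContMDiffAt (𝓡 8) (𝓡 8).tangent ∞
      (fun y => (⟨y, e.localFrame b j y⟩ : TangentBundle (𝓡 8) P)) z := fun j =>
    contMDiffAt_localFrame_of_mem (I := 𝓡 8) ∞ e b j hz
  let B : P → Matrix (Fin 8) (Fin 8) ℝ := fun y =>
    Matrix.of fun k j => gCoord (Q.form y (e.localFrame b j y)) k
  have hB : ∀ k j, ContMDiffAt (𝓡 8) 𝓘(ℝ, ℝ) ∞ (fun y => B y k j) z := fun k j =>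
    contMDiffAt_linear (Q.smooth_form_field (hs j)) ((LinearMap.proj k).comp gCoord)
  have hlin : ∀ y (c : Fin 8 → ℝ),
      Q.formI y (∑ j, c j • e.localFrame b j y) = B y *ᵥ c := by
    intro y c
    rw [formI_eq, map_sum, map_sum]
    ext k
    simp [B, Matrix.mulVec, dotProduct, mul_comm]
  have hdet : ∀ y ∈ e.baseSet, (B y).det ≠ 0 := by
    intro y hy
    rw [← isUnit_iff_ne_zero, ← Matrix.isUnit_iff_isUnit_det, ← Matrix.mulVec_injective_iff_isUnit]
    intro c d hcd
    simp only [← hlin] at hcd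
    have h2 : ∑ j, c j • e.localFrame b j y = ∑ j, d j • e.localFrame b j y :=
      (Q.formI_bijective y).1 hcd
    have hli := (e.isLocalFrameOn_localFrame_baseSet (𝓡 8) ∞ b).linearIndependent hy
    rw [← sub_eq_zero, ← Finset.sum_sub_distrib] at h2
    simp only [← sub_smul] at h2
    funext j
    exact sub_eq_zero.1 (Fintype.linearIndependent_iff.1 hli _ h2 j)
  have hframe : ∀ y ∈ e.baseSet,
      Q.framing i y = ∑ j, (B y)⁻¹ j i • e.localFrame b j y := by
    intro y hy
    refine (Q.formI_bijective y).1 ?_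
    change Q.formI y _ = Q.formI y _
    rw [formI_framing, hlin]
    have h3 : (fun j => (B y)⁻¹ j i) = (B y)⁻¹ *ᵥ Pi.single i 1 := by
      ext j; simp
    rw [h3, Matrix.mulVec_mulVec, Matrix.mul_nonsing_inv _ (hdet y hy).isUnit, Matrix.one_mulVec]
  have hsum := ContMDiffAt.sum_section (I := 𝓡 8) (n := ∞) (s := Finset.univ)
    (t := fun j y => (B y)⁻¹ j i • e.localFrame b j y) (x₀ := z) fun j _ =>
      (contMDiffAt_inv_apply hB (hdet z hz) j i).smul_section (hs j)
  refine hsum.congr_of_eventuallyEq ?_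
  filter_upwards [e.open_baseSet.mem_nhds hz] with y hy
  rw [hframe y hy]

end ExtrinsicCartanBundle
end

/-! ### The bracket of `𝔩` in coordinates -/

@[simp] theorem rMat_zero : rMat 0 = 0 := by
  ext i j
  fin_cases i <;> fin_cases j <;> simp [rMat]

@[simp] theorem sMat_zero : sMat 0 = 0 := by
  ext i j
  fin_cases i <;> fin_cases j <;> simp [sMat]

@[simp] theorem adM_toMat_zero : adM (toMat 0) = 0 := by
  rw [adM_toMat]
  ext i j
  fin_cases i <;> fin_cases j <;> simp

section

variable (c d : Fin 8 → ℝ) (r s q w : Fin 10 → ℝ)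

@[simp] theorem gCoord_adM : gCoord (adM (toMat c)) = c := by simpa using gCoord_add c 0 0
@[simp] theorem gCoord_rMat : gCoord (rMat r) = 0 := by simpa using gCoord_add 0 r 0
@[simp] theorem gCoord_sMat : gCoord (sMat s) = 0 := by simpa using gCoord_add 0 0 s
@[simp] theorem rCoord_adM : rCoord (adM (toMat c)) = 0 := by simpa using rCoord_add c 0 0
@[simp] theorem rCoord_rMat : rCoord (rMat r) = r := by simpa using rCoord_add 0 r 0
@[simp] theorem rCoord_sMat : rCoord (sMat s) = 0 := by simpa using rCoord_add 0 0 s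
@[simp] theorem sCoord_adM : sCoord (adM (toMat c)) = 0 := by simpa using sCoord_add c 0 0
@[simp] theorem sCoord_rMat : sCoord (rMat r) = 0 := by simpa using sCoord_add 0 r 0
@[simp] theorem sCoord_sMat : sCoord (sMat s) = s := by simpa using sCoord_add 0 0 s

theorem lie_eq :
    ⁅adM (toMat c) + rMat r + sMat s, adM (toMat d) + rMat q + sMat w⁆ =
      adM (toMat (gBracket c d)) + rMat (actR c q) + sMat (actS c w)
        - rMat (actR d r) + sMat (perpBracket r q) + adM (toMat (perpPairing r w))
        - sMat (actS d s) - adM (toMat (perpPairing q s)) + rMat (-perpBracket s w) := by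
  rw [← lie_adM_adM, ← lie_adM_rMat, ← lie_adM_rMat, ← lie_adM_sMat, ← lie_adM_sMat,
    ← lie_rMat_rMat, ← lie_rMat_sMat, ← lie_rMat_sMat, ← lie_sMat_sMat]
  simp only [Ring.lie_def]
  noncomm_ring

theorem gCoord_lie :
    gCoord ⁅adM (toMat c) + rMat r + sMat s, adM (toMat d) + rMat q + sMat w⁆ =
      gBracket c d + perpPairing r w - perpPairing q s := by
  rw [lie_eq]
  simp

theorem rCoord_lie :
    rCoord ⁅adM (toMat c) + rMat r + sMat s, adM (toMat d) + rMat q + sMat w⁆ =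
      actR c q - actR d r - perpBracket s w := by
  rw [lie_eq]
  simp only [map_add, map_sub, rCoord_adM, rCoord_rMat, rCoord_sMat]
  abel

theorem sCoord_lie :
    sCoord ⁅adM (toMat c) + rMat r + sMat s, adM (toMat d) + rMat q + sMat w⁆ =
      actS c w - actS d s + perpBracket r q := by
  rw [lie_eq]
  simp only [map_add, map_sub, sCoord_adM, sCoord_rMat, sCoord_sMat]
  abel

end

/-! ### The grading of `𝔤^⊥` -/

/-- The degrees, in the contact grading, of the weight vectors underlying `rMat` and `sMat`. They
agree for the two summands. -/
def perpDeg : Fin 10 → ℤ := ![3, 2, 1, 1, 0, 0, -1, -1, -2, -3]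

theorem rCoord_eq_zero {X : Matrix (Fin 8) (Fin 8) ℝ} {a : Fin 10}
    (h : ∀ i j, deg i - deg j = perpDeg a → X i j = 0) : rCoord X a = 0 := by
  fin_cases a <;> simp [perpDeg] at h <;> simp (disch := decide) [rCoord, h]

theorem sCoord_eq_zero {X : Matrix (Fin 8) (Fin 8) ℝ} {a : Fin 10}
    (h : ∀ i j, deg i - deg j = perpDeg a → X i j = 0) : sCoord X a = 0 := by
  fin_cases a <;> simp [perpDeg] at h <;> simp (disch := decide) [sCoord, h]

theorem degPart_rMat (p : ℤ) (r : Fin 10 → ℝ) :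
    degPart p (rMat r) = rMat fun a => if perpDeg a = p then r a else 0 := by
  ext i j
  by_cases h : deg i - deg j = p
  · subst h
    fin_cases i <;> fin_cases j <;> simp [degPart, rMat, deg, perpDeg]
  · rw [degPart, Matrix.of_apply, if_neg h]
    fin_cases i <;> fin_cases j <;> simp [deg] at h <;> simp [rMat, perpDeg, h]

theorem degPart_sMat (p : ℤ) (s : Fin 10 → ℝ) :
    degPart p (sMat s) = sMat fun a => if perpDeg a = p then s a else 0 := by
  ext i j
  by_cases h : deg i - deg j = p
  · subst h
    fin_cases i <;> fin_cases j <;> simp [degPart, sMat, deg, perpDeg]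
  · rw [degPart, Matrix.of_apply, if_neg h]
    fin_cases i <;> fin_cases j <;> simp [deg] at h <;> simp [sMat, perpDeg, h]

theorem degPart_add (p : ℤ) (X Y : Matrix (Fin 8) (Fin 8) ℝ) :
    degPart p (X + Y) = degPart p X + degPart p Y := by
  ext i j
  simp only [degPart, Matrix.of_apply, Matrix.add_apply]
  split_ifs <;> simp

theorem R21_eq : R21 = rMat (Pi.single 0 1) := by
  ext i j
  fin_cases i <;> fin_cases j <;> simp [R21, rMat]

theorem S12_eq : S12 = sMat (Pi.single 0 1) := by
  ext i j
  fin_cases i <;> fin_cases j <;> simp [S12, sMat]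

/-- The factor `6` arises from applying `ad e₁` three times to the highest weight vector. -/
theorem Rm11_eq : Rm11 = rMat (Pi.single 5 6) := by
  rw [Rm11, R21_eq, ← toMat_single, lie_adM_rMat, lie_adM_rMat, lie_adM_rMat]
  congr 1
  ext a
  fin_cases a <;> simp [actR, eIdx]
  norm_num

theorem S1m1_eq : S1m1 = sMat (Pi.single 5 6) := by
  rw [S1m1, S12_eq, ← toMat_single, lie_adM_sMat, lie_adM_sMat, lie_adM_sMat]
  congr 1
  ext a
  fin_cases a <;> simp [actS, eIdx]
  norm_num

/-! ### The structure equation on the framing -/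

theorem lie_adM_perp (c : Fin 8 → ℝ) (r s : Fin 10 → ℝ) :
    ⁅adM (toMat c), rMat r + sMat s⁆ = rMat (actR c r) + sMat (actS c s) := by
  rw [← lie_adM_rMat, ← lie_adM_sMat]
  simp only [Ring.lie_def]
  noncomm_ring

section

variable {M P : Type*} [TopologicalSpace M] [ChartedSpace (EuclideanSpace ℝ (Fin 3)) M]
  [TopologicalSpace P] [ChartedSpace (EuclideanSpace ℝ (Fin 8)) P]
  [IsManifold (𝓡 8) ∞ P]

namespace ExtrinsicCartanBundle
variable (Q : ExtrinsicCartanBundle M P)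

/-- The `S³(ℝ³)`-component of `χ(Aᵢ)`, in coordinates, as a function on `P`. -/
noncomputable def coR (i : Fin 8) (z : P) : Fin 10 → ℝ := rCoord (Q.form z (Q.framing i z))

/-- The `S³(ℝ³)*`-component of `χ(Aᵢ)`, in coordinates, as a function on `P`. -/
noncomputable def coS (i : Fin 8) (z : P) : Fin 10 → ℝ := sCoord (Q.form z (Q.framing i z))

theorem gCoord_form_framing (i : Fin 8) (z : P) :
    gCoord (Q.form z (Q.framing i z)) = Pi.single i 1 := by
  rw [← formI_eq, formI_framing]

theorem form_framing (i : Fin 8) (z : P) : Q.form z (Q.framing i z) =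
    adM (toMat (Pi.single i 1)) + rMat (Q.coR i z) + sMat (Q.coS i z) := by
  conv_lhs => rw [orthAlg_eq (Q.form_mem _ _), gCoord_form_framing]
  rfl

theorem rCoord_form_framing (i : Fin 8) (z : P) :
    rCoord (Q.form z (Q.framing i z)) = Q.coR i z := rfl

theorem sCoord_form_framing (i : Fin 8) (z : P) :
    sCoord (Q.form z (Q.framing i z)) = Q.coS i z := rfl

theorem χ_eq (z : P) (i : Fin 8) : Q.χ z i = rMat (Q.coR i z) + sMat (Q.coS i z) := by
  rw [χ, formII, perpPart, gPart_eq (Q.form_mem _ _), gCoord_form_framing, form_framing]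
  abel

theorem rCoord_χ (z : P) (i : Fin 8) : rCoord (Q.χ z i) = Q.coR i z := by simp [χ_eq]

theorem sCoord_χ (z : P) (i : Fin 8) : sCoord (Q.χ z i) = Q.coS i z := by simp [χ_eq]

theorem contMDiff_form_framing (L : Matrix (Fin 8) (Fin 8) ℝ →ₗ[ℝ] ℝ) (i : Fin 8) :
    ContMDiff (𝓡 8) 𝓘(ℝ, ℝ) ∞ fun z => L (Q.form z (Q.framing i z)) := fun z =>
  contMDiffAt_linear (Q.smooth_form_field (Q.isSmoothField_framing i z)) L

theorem contMDiff_coR (i : Fin 8) (a : Fin 10) :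
    ContMDiff (𝓡 8) 𝓘(ℝ, ℝ) ∞ fun z => Q.coR i z a :=
  Q.contMDiff_form_framing ((LinearMap.proj a).comp rCoord) i

theorem contMDiff_coS (i : Fin 8) (a : Fin 10) :
    ContMDiff (𝓡 8) 𝓘(ℝ, ℝ) ∞ fun z => Q.coS i z a :=
  Q.contMDiff_form_framing ((LinearMap.proj a).comp sCoord) i

/-- A linear functional of the structure equation `dω + ½[ω, ω] = 0`, evaluated on two fields with
constant `ω_I`. -/
theorem form_flat_framing (L : Matrix (Fin 8) (Fin 8) ℝ →ₗ[ℝ] ℝ) (i j : Fin 8) (z : P) :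
    lieD (Q.framing i) (fun y => L (Q.form y (Q.framing j y))) z
      - lieD (Q.framing j) (fun y => L (Q.form y (Q.framing i y))) z
      - L (Q.form z (VectorField.mlieBracket (𝓡 8) (Q.framing i) (Q.framing j) z))
      + L ⁅Q.form z (Q.framing i z), Q.form z (Q.framing j z)⁆ = 0 := by
  have hd : ∀ i k l, MDifferentiableAt (𝓡 8) 𝓘(ℝ, ℝ) (fun y => Q.form y (Q.framing i y) k l) z :=
    fun i k l => (Q.smooth_form_field (Q.isSmoothField_framing i z) k l).mdifferentiableAt (by simp)
  rw [lieD_linear (hd j), lieD_linear (hd i), ← map_sub, ← map_sub, ← map_add]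
  convert map_zero L
  ext k l
  exact Q.form_flat _ _ (Q.isSmoothField_framing i) (Q.isSmoothField_framing j) z k l

theorem eq_sum_framing (z : P) (v : TangentSpace (𝓡 8) z) :
    v = ∑ k, Q.formI z v k • Q.framing k z := by
  refine (Q.formI_bijective z).1 ?_
  change Q.formI z v = Q.formI z _
  conv_rhs => rw [formI_eq, map_sum, map_sum]
  ext l
  simp [gCoord_form_framing, Pi.single_apply]

/-- The `𝔤`-component of the structure equation computes the brackets of the fields with constant
`ω_I`: the derivative terms vanish, and the bracket `[ω_I, ω_I]` is corrected by the `𝔤`-component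
of `[ω_II, ω_II]`. -/
theorem formI_mlieBracket (i j : Fin 8) (z : P) :
    Q.formI z (VectorField.mlieBracket (𝓡 8) (Q.framing i) (Q.framing j) z) =
      gBracket (Pi.single i 1) (Pi.single j 1) + perpPairing (Q.coR i z) (Q.coS j z)
        - perpPairing (Q.coR j z) (Q.coS i z) := by
  ext k
  have h := Q.form_flat_framing ((LinearMap.proj k).comp gCoord) i j z
  simp only [LinearMap.comp_apply, LinearMap.proj_apply, ← formI_eq, formI_framing,
    lieD_const] at h
  rw [form_framing, form_framing, gCoord_lie] at h
  linarith

/-- The `S³(ℝ³)`-component of the structure equation: a first-order system for the components of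
`χ`, with structure functions that are themselves polynomials in `χ`. -/
theorem structure_eq_coR (i j : Fin 8) (z : P) (a : Fin 10) :
    lieD (Q.framing i) (fun y => Q.coR j y a) z - lieD (Q.framing j) (fun y => Q.coR i y a) z
      - ∑ k, (gBracket (Pi.single i 1) (Pi.single j 1) + perpPairing (Q.coR i z) (Q.coS j z)
        - perpPairing (Q.coR j z) (Q.coS i z)) k * Q.coR k z a
      + (actR (Pi.single i 1) (Q.coR j z) - actR (Pi.single j 1) (Q.coR i z)
        - perpBracket (Q.coS i z) (Q.coS j z)) a = 0 := by
  have h := Q.form_flat_framing ((LinearMap.proj a).comp rCoord) i j z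
  rw [Q.eq_sum_framing z (VectorField.mlieBracket (𝓡 8) (Q.framing i) (Q.framing j) z),
    formI_mlieBracket, map_sum, map_sum] at h
  rw [Q.form_framing i z, Q.form_framing j z, LinearMap.comp_apply _ _ ⁅_, _⁆, rCoord_lie] at h
  simpa [rCoord_form_framing] using h

/-- The `S³(ℝ³)*`-component of the structure equation. -/
theorem structure_eq_coS (i j : Fin 8) (z : P) (a : Fin 10) :
    lieD (Q.framing i) (fun y => Q.coS j y a) z - lieD (Q.framing j) (fun y => Q.coS i y a) z
      - ∑ k, (gBracket (Pi.single i 1) (Pi.single j 1) + perpPairing (Q.coR i z) (Q.coS j z)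
        - perpPairing (Q.coR j z) (Q.coS i z)) k * Q.coS k z a
      + (actS (Pi.single i 1) (Q.coS j z) - actS (Pi.single j 1) (Q.coS i z)
        + perpBracket (Q.coR i z) (Q.coR j z)) a = 0 := by
  have h := Q.form_flat_framing ((LinearMap.proj a).comp sCoord) i j z
  rw [Q.eq_sum_framing z (VectorField.mlieBracket (𝓡 8) (Q.framing i) (Q.framing j) z),
    formI_mlieBracket, map_sum, map_sum] at h
  rw [Q.form_framing i z, Q.form_framing j z, LinearMap.comp_apply _ _ ⁅_, _⁆, sCoord_lie] at h
  simpa [sCoord_form_framing] using h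

end ExtrinsicCartanBundle

namespace NormalExtrinsicCartanBundle
variable (Q : NormalExtrinsicCartanBundle M P)

theorem coR_borel (z : P) (i : Fin 8) (hi : 0 ≤ deg i) : Q.coR i z = 0 := by
  rw [← Q.rCoord_χ, Q.χ_borel z i hi, map_zero]

theorem coS_borel (z : P) (i : Fin 8) (hi : 0 ≤ deg i) : Q.coS i z = 0 := by
  rw [← Q.sCoord_χ, Q.χ_borel z i hi, map_zero]

theorem χ_apply_eq_zero (z : P) (k : Fin 3) {i j : Fin 8} (h : deg i - deg j ≤ deg (eIdx k)) :
    Q.χ z (eIdx k) i j = 0 := by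
  have h2 := congrFun (congrFun (congrFun
    (Q.χ_positive z (deg i - deg j - deg (eIdx k)) (by linarith)) k) i) j
  simpa [cochainPart, degPart, ExtrinsicCartanBundle.χMinus] using h2

/-- The components of `χ` of homogeneous degree at most `0` vanish: the component at `e_k` with
coordinate `a` has degree `perpDeg a - deg e_k`. -/
theorem coR_eq_zero (z : P) (k : Fin 3) {a : Fin 10} (h : perpDeg a ≤ deg (eIdx k)) :
    Q.coR (eIdx k) z a = 0 := by
  rw [← Q.rCoord_χ]
  exact rCoord_eq_zero fun i j hij => Q.χ_apply_eq_zero z k (hij.trans_le h)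

theorem coS_eq_zero (z : P) (k : Fin 3) {a : Fin 10} (h : perpDeg a ≤ deg (eIdx k)) :
    Q.coS (eIdx k) z a = 0 := by
  rw [← Q.sCoord_χ]
  exact sCoord_eq_zero fun i j hij => Q.χ_apply_eq_zero z k (hij.trans_le h)

/-- The normalization `∂* χ = 0` in the summand `S³(ℝ³)`. -/
theorem codiff_coR (z : P) :
    ∑ k, actR (Pi.single (eCheckIdx k) 1) (Q.coR (eIdx k) z) = 0 := by
  have h := congrArg rCoord (Q.χ_normal z)
  simpa [codiff, ExtrinsicCartanBundle.χMinus, Q.χ_eq, ← toMat_single, lie_adM_perp,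
    Fin.sum_univ_three] using h

/-- The normalization `∂* χ = 0` in the summand `S³(ℝ³)*`. -/
theorem codiff_coS (z : P) :
    ∑ k, actS (Pi.single (eCheckIdx k) 1) (Q.coS (eIdx k) z) = 0 := by
  have h := congrArg sCoord (Q.χ_normal z)
  simpa [codiff, ExtrinsicCartanBundle.χMinus, Q.χ_eq, ← toMat_single, lie_adM_perp,
    Fin.sum_univ_three] using h

end NormalExtrinsicCartanBundle
end

/-! ### The structure equation in each homogeneous degree -/

section

variable {M P : Type*} [TopologicalSpace M] [ChartedSpace (EuclideanSpace ℝ (Fin 3)) M]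
  [TopologicalSpace P] [ChartedSpace (EuclideanSpace ℝ (Fin 8)) P]
  [IsManifold (𝓡 8) ∞ P]

namespace NormalExtrinsicCartanBundle
variable (Q : NormalExtrinsicCartanBundle M P)

/-- The components of `χ` in `S³(ℝ³)` of homogeneous degree at most `0`. -/
theorem coR_low (z : P) : Q.coR 7 z 8 = 0 ∧ Q.coR 7 z 9 = 0 ∧
    Q.coR 6 z 6 = 0 ∧ Q.coR 6 z 7 = 0 ∧ Q.coR 6 z 8 = 0 ∧ Q.coR 6 z 9 = 0 ∧
    Q.coR 5 z 6 = 0 ∧ Q.coR 5 z 7 = 0 ∧ Q.coR 5 z 8 = 0 ∧ Q.coR 5 z 9 = 0 :=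
  ⟨Q.coR_eq_zero z 0 (by decide), Q.coR_eq_zero z 0 (by decide),
    Q.coR_eq_zero z 1 (by decide), Q.coR_eq_zero z 1 (by decide),
    Q.coR_eq_zero z 1 (by decide), Q.coR_eq_zero z 1 (by decide),
    Q.coR_eq_zero z 2 (by decide), Q.coR_eq_zero z 2 (by decide),
    Q.coR_eq_zero z 2 (by decide), Q.coR_eq_zero z 2 (by decide)⟩

/-- The components of `χ` in `S³(ℝ³)*` of homogeneous degree at most `0`. -/
theorem coS_low (z : P) : Q.coS 7 z 8 = 0 ∧ Q.coS 7 z 9 = 0 ∧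
    Q.coS 6 z 6 = 0 ∧ Q.coS 6 z 7 = 0 ∧ Q.coS 6 z 8 = 0 ∧ Q.coS 6 z 9 = 0 ∧
    Q.coS 5 z 6 = 0 ∧ Q.coS 5 z 7 = 0 ∧ Q.coS 5 z 8 = 0 ∧ Q.coS 5 z 9 = 0 :=
  ⟨Q.coS_eq_zero z 0 (by decide), Q.coS_eq_zero z 0 (by decide),
    Q.coS_eq_zero z 1 (by decide), Q.coS_eq_zero z 1 (by decide),
    Q.coS_eq_zero z 1 (by decide), Q.coS_eq_zero z 1 (by decide),
    Q.coS_eq_zero z 2 (by decide), Q.coS_eq_zero z 2 (by decide),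
    Q.coS_eq_zero z 2 (by decide), Q.coS_eq_zero z 2 (by decide)⟩

theorem co_borel (z : P) : (Q.coR 0 z = 0 ∧ Q.coR 1 z = 0 ∧ Q.coR 2 z = 0 ∧ Q.coR 3 z = 0 ∧
    Q.coR 4 z = 0) ∧ (Q.coS 0 z = 0 ∧ Q.coS 1 z = 0 ∧ Q.coS 2 z = 0 ∧ Q.coS 3 z = 0 ∧
    Q.coS 4 z = 0) :=
  ⟨⟨Q.coR_borel z 0 (by decide), Q.coR_borel z 1 (by decide), Q.coR_borel z 2 (by decide),
    Q.coR_borel z 3 (by decide), Q.coR_borel z 4 (by decide)⟩,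
    Q.coS_borel z 0 (by decide), Q.coS_borel z 1 (by decide), Q.coS_borel z 2 (by decide),
    Q.coS_borel z 3 (by decide), Q.coS_borel z 4 (by decide)⟩

/-- In homogeneous degree `1` the structure equation involves no derivatives. Together with `∂* χ =
0` it leaves exactly two components of `χ`, the coordinate `5` of `S³(ℝ³)` at `e₂` and the
coordinate `5` of `S³(ℝ³)*` at `e₁`. -/
theorem relations_degree_one (z : P) : (Q.coR 7 z 6 = 0 ∧ Q.coR 7 z 7 = 0 ∧ Q.coR 6 z 4 = 0 ∧
      Q.coR 6 z 5 = 0 ∧ Q.coR 5 z 4 = 0) ∧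
    (Q.coS 7 z 6 = 0 ∧ Q.coS 7 z 7 = 0 ∧ Q.coS 6 z 4 = 0 ∧ Q.coS 5 z 4 = 0 ∧ Q.coS 5 z 5 = 0) := by
  have c2 := congrFun (Q.codiff_coR z) 2
  have c3 := congrFun (Q.codiff_coR z) 3
  have d2 := congrFun (Q.codiff_coS z) 2
  have d3 := congrFun (Q.codiff_coS z) 3
  have a6 := Q.structure_eq_coR 6 5 z 6
  have a7 := Q.structure_eq_coR 6 5 z 7
  have b6 := Q.structure_eq_coS 6 5 z 6
  have b7 := Q.structure_eq_coS 6 5 z 7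
  have e8 := Q.structure_eq_coR 7 5 z 8
  have f8 := Q.structure_eq_coS 7 6 z 8
  simp [Fin.sum_univ_three, actR, eCheckIdx, eIdx, Q.coR_low] at c2 c3
  simp [Fin.sum_univ_three, actS, eCheckIdx, eIdx, Q.coS_low] at d2 d3
  simp [Fin.sum_univ_eight, gBracket, perpPairing, actR, perpBracket, Q.coR_low, Q.coS_low,
    Q.co_borel, lieD_const] at a6 a7 e8
  simp [Fin.sum_univ_eight, gBracket, perpPairing, actS, perpBracket, Q.coR_low, Q.coS_low,
    Q.co_borel, lieD_const] at b6 b7 f8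
  refine ⟨⟨?_, ?_, ?_, ?_, ?_⟩, ?_, ?_, ?_, ?_, ?_⟩ <;> linarith

/-- In homogeneous degree `2` all components are multiples of the coordinate `5` at `e₀`, which is
the derivative along `e₁` (respectively `e₂`) of the surviving component of degree `1`. -/
theorem relations_degree_two (z : P) :
    (Q.coR 7 z 4 = 0 ∧ Q.coR 6 z 2 = 0 ∧ Q.coR 6 z 3 = 0 ∧ Q.coR 5 z 2 = 0 ∧
      Q.coR 5 z 3 = Q.coR 7 z 5 ∧
      lieD (Q.framing 6) (fun y => Q.coR 5 y 5) z = -4 * Q.coR 7 z 5) ∧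
    (Q.coS 7 z 4 = 0 ∧ Q.coS 5 z 2 = 0 ∧ Q.coS 5 z 3 = 0 ∧ Q.coS 6 z 2 = 0 ∧
      Q.coS 6 z 3 = -Q.coS 7 z 5 ∧
      lieD (Q.framing 5) (fun y => Q.coS 6 y 5) z = 4 * Q.coS 7 z 5) := by
  have a6 := Q.structure_eq_coR 7 6 z 6
  have a7 := Q.structure_eq_coR 7 6 z 7
  have b6 := Q.structure_eq_coR 7 5 z 6
  have b7 := Q.structure_eq_coR 7 5 z 7
  have e5 := Q.structure_eq_coR 6 5 z 5
  have k6 := Q.structure_eq_coS 7 6 z 6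
  have k7 := Q.structure_eq_coS 7 6 z 7
  have l6 := Q.structure_eq_coS 7 5 z 6
  have l7 := Q.structure_eq_coS 7 5 z 7
  have m5 := Q.structure_eq_coS 6 5 z 5
  have c1 := congrFun (Q.codiff_coR z) 1
  have d1 := congrFun (Q.codiff_coS z) 1
  simp [Fin.sum_univ_three, actR, eCheckIdx, eIdx, Q.relations_degree_one] at c1
  simp [Fin.sum_univ_three, actS, eCheckIdx, eIdx, Q.relations_degree_one] at d1
  simp [Fin.sum_univ_eight, gBracket, perpPairing, actR, perpBracket, Q.coR_low, Q.coS_low,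
    Q.co_borel, lieD_const, Q.relations_degree_one] at a6 a7 b6 b7 e5
  simp [Fin.sum_univ_eight, gBracket, perpPairing, actS, perpBracket, Q.coR_low, Q.coS_low,
    Q.co_borel, lieD_const, Q.relations_degree_one] at k6 k7 l6 l7 m5
  refine ⟨⟨?_, ?_, ?_, ?_, ?_, ?_⟩, ⟨?_, ?_, ?_, ?_, ?_, ?_⟩⟩ <;> linarith

/-- In homogeneous degree `3`. The last identity of each group comes from the mixed equation for
`e₀, e₂` (respectively `e₀, e₁`); it yields the second-order condition on `h₁ᴿ` (respectively
`h₁ˢ`). -/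
theorem relations_degree_three (z : P) :
    (Q.coR 7 z 2 = 0 ∧ Q.coR 6 z 1 = 0 ∧ Q.coR 5 z 1 = Q.coR 7 z 3 ∧
      lieD (Q.framing 6) (fun y => Q.coR 7 y 5) z = -3 * Q.coR 7 z 3 ∧
      lieD (Q.framing 7) (fun y => Q.coR 5 y 5) z = lieD (Q.framing 5) (fun y => Q.coR 7 y 5) z) ∧
    (Q.coS 7 z 2 = 0 ∧ Q.coS 5 z 1 = 0 ∧ Q.coS 6 z 1 = -Q.coS 7 z 3 ∧
      lieD (Q.framing 5) (fun y => Q.coS 7 y 5) z = -3 * Q.coS 7 z 3 ∧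
      lieD (Q.framing 7) (fun y => Q.coS 6 y 5) z =
        lieD (Q.framing 6) (fun y => Q.coS 7 y 5) z) := by
  have a4 := Q.structure_eq_coR 7 6 z 4
  have a5 := Q.structure_eq_coR 7 6 z 5
  have b4 := Q.structure_eq_coR 7 5 z 4
  have b5 := Q.structure_eq_coR 7 5 z 5
  have k4 := Q.structure_eq_coS 7 6 z 4
  have k5 := Q.structure_eq_coS 7 6 z 5
  have l4 := Q.structure_eq_coS 7 5 z 4
  have l5 := Q.structure_eq_coS 7 5 z 5
  have c1 := congrFun (Q.codiff_coR z) 0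
  have d1 := congrFun (Q.codiff_coS z) 0
  simp [Fin.sum_univ_three, actR, eCheckIdx, eIdx, Q.relations_degree_two] at c1
  simp [Fin.sum_univ_three, actS, eCheckIdx, eIdx, Q.relations_degree_two] at d1
  simp [Fin.sum_univ_eight, gBracket, perpPairing, actR, perpBracket, Q.coR_low, Q.coS_low,
    Q.co_borel, lieD_const, Q.relations_degree_one, Q.relations_degree_two] at a4 a5 b4 b5
  simp [Fin.sum_univ_eight, gBracket, perpPairing, actS, perpBracket, Q.coR_low, Q.coS_low,
    Q.co_borel, lieD_const, Q.relations_degree_one, Q.relations_degree_two] at k4 k5 l4 l5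
  refine ⟨⟨?_, ?_, ?_, ?_, ?_⟩, ⟨?_, ?_, ?_, ?_, ?_⟩⟩ <;> linarith

theorem relations_degree_four (z : P) :
    (Q.coR 6 z 0 = 0 ∧ Q.coR 5 z 0 = Q.coR 7 z 1 ∧
      lieD (Q.framing 6) (fun y => Q.coR 7 y 3) z = -2 * Q.coR 7 z 1) ∧
    (Q.coS 5 z 0 = 0 ∧ Q.coS 6 z 0 = -Q.coS 7 z 1 ∧
      lieD (Q.framing 5) (fun y => Q.coS 7 y 3) z = -2 * Q.coS 7 z 1) := by
  have a2 := Q.structure_eq_coR 7 6 z 2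
  have a3 := Q.structure_eq_coR 7 6 z 3
  have b2 := Q.structure_eq_coR 7 5 z 2
  have k2 := Q.structure_eq_coS 7 6 z 2
  have l2 := Q.structure_eq_coS 7 5 z 2
  have l3 := Q.structure_eq_coS 7 5 z 3
  simp [Fin.sum_univ_eight, gBracket, perpPairing, actR, perpBracket, Q.coR_low, Q.coS_low,
    Q.co_borel, lieD_const, Q.relations_degree_one, Q.relations_degree_two,
    Q.relations_degree_three] at a2 a3 b2
  simp [Fin.sum_univ_eight, gBracket, perpPairing, actS, perpBracket, Q.coR_low, Q.coS_low,
    Q.co_borel, lieD_const, Q.relations_degree_one, Q.relations_degree_two,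
    Q.relations_degree_three] at k2 l2 l3
  refine ⟨⟨?_, ?_, ?_⟩, ⟨?_, ?_, ?_⟩⟩ <;> linarith

theorem relations_degree_five (z : P) :
    (lieD (Q.framing 6) (fun y => Q.coR 7 y 1) z = -Q.coR 7 z 0) ∧
    (lieD (Q.framing 5) (fun y => Q.coS 7 y 1) z = -Q.coS 7 z 0) := by
  have a1 := Q.structure_eq_coR 7 6 z 1
  have l1 := Q.structure_eq_coS 7 5 z 1
  simp [Fin.sum_univ_eight, gBracket, perpPairing, actR, perpBracket, Q.coR_low, Q.coS_low,
    Q.co_borel, lieD_const, Q.relations_degree_one, Q.relations_degree_two,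
    Q.relations_degree_three, Q.relations_degree_four] at a1
  simp [Fin.sum_univ_eight, gBracket, perpPairing, actS, perpBracket, Q.coR_low, Q.coS_low,
    Q.co_borel, lieD_const, Q.relations_degree_one, Q.relations_degree_two,
    Q.relations_degree_three, Q.relations_degree_four] at l1
  refine ⟨?_, ?_⟩ <;> linarith

/-- No component of `χ` has homogeneous degree `6`, so the next equation in the chain closes up. Its
right-hand side is quadratic, from the bracket of `S³(ℝ³)*` with itself (respectively of `S³(ℝ³)`)
and the corrections to the brackets of the framing fields. -/
theorem relations_degree_six (z : P) :
    (lieD (Q.framing 6) (fun y => Q.coR 7 y 0) z =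
      -Q.coS 7 z 0 * Q.coS 6 z 5 - 4 * Q.coS 7 z 1 * Q.coS 7 z 5 + 3 * Q.coS 7 z 3 ^ 2) ∧
    (lieD (Q.framing 5) (fun y => Q.coS 7 y 0) z =
      Q.coR 7 z 0 * Q.coR 5 z 5 - 4 * Q.coR 7 z 1 * Q.coR 7 z 5 + 3 * Q.coR 7 z 3 ^ 2) := by
  have a0 := Q.structure_eq_coR 7 6 z 0
  have l0 := Q.structure_eq_coS 7 5 z 0
  simp [Fin.sum_univ_eight, gBracket, perpPairing, actR, perpBracket, Q.coR_low, Q.coS_low,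
    Q.co_borel, lieD_const, Q.relations_degree_one, Q.relations_degree_two,
    Q.relations_degree_three, Q.relations_degree_four] at a0
  simp [Fin.sum_univ_eight, gBracket, perpPairing, actS, perpBracket, Q.coR_low, Q.coS_low,
    Q.co_borel, lieD_const, Q.relations_degree_one, Q.relations_degree_two,
    Q.relations_degree_three, Q.relations_degree_four] at l0
  refine ⟨?_, ?_⟩ <;> linarith

end NormalExtrinsicCartanBundle
end

/-! ### The functions `h₁ᴿ`, `h₁ˢ` and their derivatives -/

theorem smul_rMat (c : ℝ) (r : Fin 10 → ℝ) : c • rMat r = rMat (c • r) := by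
  ext i j
  fin_cases i <;> fin_cases j <;> simp [rMat] <;> ring

theorem smul_sMat (c : ℝ) (s : Fin 10 → ℝ) : c • sMat s = sMat (c • s) := by
  ext i j
  fin_cases i <;> fin_cases j <;> simp [sMat] <;> ring

/-- `ξ₁ᴿ` and `ξ₁ˢ` are linearly independent. -/
theorem coeff_eq_of_xiR_xiS {x y x' y' : ℝ} (h : x • xiR + y • xiS = x' • xiR + y' • xiS) :
    x = x' ∧ y = y' := by
  constructor
  · have := congrFun (congrArg rCoord (congrFun h 2)) 5
    simpa [xiR, xiS, Rm11_eq] using this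
  · have := congrFun (congrArg sCoord (congrFun h 1)) 5
    simpa [xiR, xiS, S1m1_eq] using this

section

variable {M P : Type*} [TopologicalSpace M] [ChartedSpace (EuclideanSpace ℝ (Fin 3)) M]
  [TopologicalSpace P] [ChartedSpace (EuclideanSpace ℝ (Fin 8)) P]
  [IsManifold (𝓡 8) ∞ P]

namespace NormalExtrinsicCartanBundle
variable (Q : NormalExtrinsicCartanBundle M P)

/-- The degree `1` component of `χ`. The division by `6` compensates `R_{-1,1} = rMat (Pi.single 5
6)`. -/
theorem cochainPart_one_eq (z : P) : cochainPart 1 (Q.χMinus z) =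
    (Q.coR 5 z 5 / 6) • xiR + (Q.coS 6 z 5 / 6) • xiS := by
  have h0 : ∀ (r : Fin 10 → ℝ) (p : ℤ), (∀ a, perpDeg a = p → r a = 0) →
      (fun a => if perpDeg a = p then r a else 0) = 0 := fun r p h => by
    ext a
    simpa using h a
  have h5 : ∀ r : Fin 10 → ℝ, r 4 = 0 →
      (fun a => if perpDeg a = 0 then r a else 0) = (r 5 / 6) • Pi.single 5 6 := fun r h => by
    ext a
    fin_cases a <;> simp [perpDeg, h]
  obtain ⟨⟨a1, a2, a3, a4, a5⟩, b1, b2, b3, b4, b5⟩ := Q.relations_degree_one z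
  ext1 k
  simp only [cochainPart, ExtrinsicCartanBundle.χMinus, Q.χ_eq, degPart_add, degPart_rMat,
    degPart_sMat]
  fin_cases k
  · simp only [Fin.zero_eta, show deg 7 + 1 = -1 from rfl, show eIdx 0 = 7 from rfl]
    rw [h0, h0]
    · simp [xiR, xiS]
    all_goals
      intro a
      fin_cases a <;> simp [perpDeg, a1, a2, b1, b2]
  · simp only [Fin.mk_one, show deg 6 + 1 = 0 from rfl, show eIdx 1 = 6 from rfl]
    rw [h0, h5 _ b3]
    · simp [xiR, xiS, S1m1_eq, smul_sMat]
    · intro a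
      fin_cases a <;> simp [perpDeg, a3, a4]
  · simp only [Fin.reduceFinMk, show deg 5 + 1 = 0 from rfl, show eIdx 2 = 5 from rfl]
    rw [h5 _ a5, h0 (Q.coS 5 z)]
    · simp [xiR, xiS, Rm11_eq, smul_rMat]
    · intro a
      fin_cases a <;> simp [perpDeg, b4, b5]

theorem D_const_mul_coR (k : Fin 3) (i : Fin 8) (a : Fin 10) (c : ℝ) (z : P) :
    Q.D k (fun y => c * Q.coR i y a) z = c * lieD (Q.framing (eIdx k)) (fun y => Q.coR i y a) z :=
  lieD_const_mul ((Q.contMDiff_coR i a z).mdifferentiableAt (by simp)) c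

theorem D_const_mul_coS (k : Fin 3) (i : Fin 8) (a : Fin 10) (c : ℝ) (z : P) :
    Q.D k (fun y => c * Q.coS i y a) z = c * lieD (Q.framing (eIdx k)) (fun y => Q.coS i y a) z :=
  lieD_const_mul ((Q.contMDiff_coS i a z).mdifferentiableAt (by simp)) c

/-- The iterated derivatives of `h₁ᴿ` along `e₁` run, up to constants, through the coordinates `5,
3, 1, 0` of `S³(ℝ³)` at `e₀`; the fifth one is a quadratic expression in `S³(ℝ³)*`. -/
theorem D_iterates_coR :
    Q.D 1 (fun z => 1 / 6 * Q.coR 5 z 5) = (fun z => -(2 / 3) * Q.coR 7 z 5) ∧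
    (Q.D 1)^[2] (fun z => 1 / 6 * Q.coR 5 z 5) = (fun z => 2 * Q.coR 7 z 3) ∧
    (Q.D 1)^[3] (fun z => 1 / 6 * Q.coR 5 z 5) = (fun z => -4 * Q.coR 7 z 1) ∧
    (Q.D 1)^[4] (fun z => 1 / 6 * Q.coR 5 z 5) = (fun z => 4 * Q.coR 7 z 0) ∧
    (Q.D 1)^[5] (fun z => 1 / 6 * Q.coR 5 z 5) = fun z => 4 *
      (-Q.coS 7 z 0 * Q.coS 6 z 5 - 4 * Q.coS 7 z 1 * Q.coS 7 z 5 + 3 * Q.coS 7 z 3 ^ 2) := by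
  have e : eIdx 1 = 6 := rfl
  have h1 : Q.D 1 (fun z => 1 / 6 * Q.coR 5 z 5) = fun z => -(2 / 3) * Q.coR 7 z 5 := by
    funext z
    rw [D_const_mul_coR, e, (Q.relations_degree_two z).1.2.2.2.2.2]
    ring
  have h2 : Q.D 1 (fun z => -(2 / 3) * Q.coR 7 z 5) = fun z => 2 * Q.coR 7 z 3 := by
    funext z
    rw [D_const_mul_coR, e, (Q.relations_degree_three z).1.2.2.2.1]
    ring
  have h3 : Q.D 1 (fun z => 2 * Q.coR 7 z 3) = fun z => -4 * Q.coR 7 z 1 := by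
    funext z
    rw [D_const_mul_coR, e, (Q.relations_degree_four z).1.2.2]
    ring
  have h4 : Q.D 1 (fun z => -4 * Q.coR 7 z 1) = fun z => 4 * Q.coR 7 z 0 := by
    funext z
    rw [D_const_mul_coR, e, (Q.relations_degree_five z).1]
    ring
  have h5 : Q.D 1 (fun z => 4 * Q.coR 7 z 0) = fun z => 4 *
      (-Q.coS 7 z 0 * Q.coS 6 z 5 - 4 * Q.coS 7 z 1 * Q.coS 7 z 5 + 3 * Q.coS 7 z 3 ^ 2) := by
    funext z
    rw [D_const_mul_coR, e, (Q.relations_degree_six z).1]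
  simp only [Function.iterate_succ_apply', Function.iterate_zero_apply, h1, h2, h3, h4, h5,
    and_self]

/-- The iterated derivatives of `h₁ˢ` along `e₂`. -/
theorem D_iterates_coS :
    Q.D 2 (fun z => 1 / 6 * Q.coS 6 z 5) = (fun z => 2 / 3 * Q.coS 7 z 5) ∧
    (Q.D 2)^[2] (fun z => 1 / 6 * Q.coS 6 z 5) = (fun z => -2 * Q.coS 7 z 3) ∧
    (Q.D 2)^[3] (fun z => 1 / 6 * Q.coS 6 z 5) = (fun z => 4 * Q.coS 7 z 1) ∧
    (Q.D 2)^[4] (fun z => 1 / 6 * Q.coS 6 z 5) = (fun z => -4 * Q.coS 7 z 0) ∧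
    (Q.D 2)^[5] (fun z => 1 / 6 * Q.coS 6 z 5) = fun z => -4 *
      (Q.coR 7 z 0 * Q.coR 5 z 5 - 4 * Q.coR 7 z 1 * Q.coR 7 z 5 + 3 * Q.coR 7 z 3 ^ 2) := by
  have e : eIdx 2 = 5 := rfl
  have h1 : Q.D 2 (fun z => 1 / 6 * Q.coS 6 z 5) = fun z => 2 / 3 * Q.coS 7 z 5 := by
    funext z
    rw [D_const_mul_coS, e, (Q.relations_degree_two z).2.2.2.2.2.2]
    ring
  have h2 : Q.D 2 (fun z => 2 / 3 * Q.coS 7 z 5) = fun z => -2 * Q.coS 7 z 3 := by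
    funext z
    rw [D_const_mul_coS, e, (Q.relations_degree_three z).2.2.2.2.1]
    ring
  have h3 : Q.D 2 (fun z => -2 * Q.coS 7 z 3) = fun z => 4 * Q.coS 7 z 1 := by
    funext z
    rw [D_const_mul_coS, e, (Q.relations_degree_four z).2.2.2]
    ring
  have h4 : Q.D 2 (fun z => 4 * Q.coS 7 z 1) = fun z => -4 * Q.coS 7 z 0 := by
    funext z
    rw [D_const_mul_coS, e, (Q.relations_degree_five z).2]
    ring
  have h5 : Q.D 2 (fun z => -4 * Q.coS 7 z 0) = fun z => -4 *
      (Q.coR 7 z 0 * Q.coR 5 z 5 - 4 * Q.coR 7 z 1 * Q.coR 7 z 5 + 3 * Q.coR 7 z 3 ^ 2) := by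
    funext z
    rw [D_const_mul_coS, e, (Q.relations_degree_six z).2]
  simp only [Function.iterate_succ_apply', Function.iterate_zero_apply, h1, h2, h3, h4, h5,
    and_self]

end NormalExtrinsicCartanBundle
end

end SL3Type

theorem mainTheorem4 {M P : Type*}
    [TopologicalSpace M] [ChartedSpace (EuclideanSpace ℝ (Fin 3)) M] [IsManifold (𝓡 3) ∞ M]
    [TopologicalSpace P] [ChartedSpace (EuclideanSpace ℝ (Fin 8)) P] [IsManifold (𝓡 8) ∞ P]
    (Q : SL3Type.NormalExtrinsicCartanBundle M P) :
    (∃ hR hS : P → ℝ, ContMDiff (𝓡 8) 𝓘(ℝ, ℝ) ∞ hR ∧ ContMDiff (𝓡 8) 𝓘(ℝ, ℝ) ∞ hS ∧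
      ∀ z, SL3Type.cochainPart 1 (Q.χMinus z) = hR z • SL3Type.xiR + hS z • SL3Type.xiS) ∧
    ∀ hR hS : P → ℝ,
      (∀ z, SL3Type.cochainPart 1 (Q.χMinus z) = hR z • SL3Type.xiR + hS z • SL3Type.xiS) →
      (∀ z, Q.D 0 hR z + 1 / 4 * Q.D 2 (Q.D 1 hR) z = 0) ∧
      (∀ z, Q.D 0 hS z - 1 / 4 * Q.D 1 (Q.D 2 hS) z = 0) ∧
      (∀ z, (Q.D 2)^[5] hS z =
        -6 * (Q.D 1)^[4] hR z * hR z + 6 * (Q.D 1)^[3] hR z * Q.D 1 hR z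
          - 3 * ((Q.D 1)^[2] hR z) ^ 2) ∧
      (∀ z, (Q.D 1)^[5] hR z =
        6 * (Q.D 2)^[4] hS z * hS z - 6 * (Q.D 2)^[3] hS z * Q.D 2 hS z
          + 3 * ((Q.D 2)^[2] hS z) ^ 2) := by
  refine ⟨⟨fun z => Q.coR 5 z 5 / 6, fun z => Q.coS 6 z 5 / 6, ?_, ?_, Q.cochainPart_one_eq⟩, ?_⟩
  · exact (Q.contMDiff_coR 5 5).div_const 6
  · exact (Q.contMDiff_coS 6 5).div_const 6
  intro hR hS h
  obtain rfl : hR = fun z => 1 / 6 * Q.coR 5 z 5 := by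
    funext z
    rw [← (SL3Type.coeff_eq_of_xiR_xiS ((Q.cochainPart_one_eq z).symm.trans (h z))).1]
    ring
  obtain rfl : hS = fun z => 1 / 6 * Q.coS 6 z 5 := by
    funext z
    rw [← (SL3Type.coeff_eq_of_xiR_xiS ((Q.cochainPart_one_eq z).symm.trans (h z))).2]
    ring
  obtain ⟨r1, r2, r3, r4, r5⟩ := Q.D_iterates_coR
  obtain ⟨s1, s2, s3, s4, s5⟩ := Q.D_iterates_coS
  refine ⟨fun z => ?_, fun z => ?_, fun z => ?_, fun z => ?_⟩
  -- In degree `3`, `D_{e_0} (coR 5 · 5) = D_{e_2} (coR 7 · 5)`, and by `r1`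
  -- the function `coR 7 · 5` is a multiple of `D_{e_1} h₁ᴿ`.
  · rw [r1, Q.D_const_mul_coR, Q.D_const_mul_coR]
    change 1 / 6 * SL3Type.lieD (Q.framing 7) _ z + _ * (_ * SL3Type.lieD (Q.framing 5) _ z) = 0
    rw [(Q.relations_degree_three z).1.2.2.2.2]
    ring
  · rw [s1, Q.D_const_mul_coS, Q.D_const_mul_coS]
    change 1 / 6 * SL3Type.lieD (Q.framing 7) _ z - _ * (_ * SL3Type.lieD (Q.framing 6) _ z) = 0
    rw [(Q.relations_degree_three z).2.2.2.2.2]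
    ring
  · rw [s5, r1, r2, r3, r4]
    ring
  · rw [r5, s1, s2, s3, s4]
    ring
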